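/- For each index $l=1,2,\dots$ consider a linear model $y=X\beta^*+\varepsilon$ with $N$ observations and $n$ predictors, and an undirected graph $\mathcal G$ on the nodes $\{1,\dots,n\}$ with maximum degree $d$. All quantities may vary with $l$ except the order $k\ge 0$, the number $\nu\in[0,1)$ and the constants named below, and $N,n\to\infty$. Let $F$ be the oriented incidence matrix of $\mathcal G$ (the row of the edge $(a,b)$, $a<b$, has $-1$ at $a$, $+1$ at $b$ and $0$ elsewhere), $L=F^TF$, and let $\Delta^{(k+1)}=FL^{k/2}$ for even $k$ and $\Delta^{(k+1)}=L^{(k+1)/2}$ for odd $k$. Write $\|v\|_0$ for the number of nonzero entries of a vector $v$. Assume the following. (i) $\|\Delta^{(k+1)}\beta^*\|_0\le s_1$ and $\|\beta^*\|_0\le s_2$ for integers $s_1,s_2\ge1$ with $s_2/s_1\ge\nu$. (ii) The rows $X_i$ of $X$ are i.i.d. with mean zero and covariance matrix $\Sigma_x$, and are $\sigma_x$-sub-Gaussian: $\mathbb E\exp(t\,u^TX_i)\le\exp(\sigma_x^2t^2/2)$ for all $t\in\mathbb R$ and all unit vectors $u$. The eigenvalues of $\Sigma_x$ lie in $[c,c']$.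 Here $\sigma_x,c,c'>0$ are constants. (iii) $\varepsilon\sim N(0,\sigma_\varepsilon^2I_N)$ is independent of $X$, and $\sigma_\varepsilon>0$ is known. (iv) Every row of $\Theta_x=\Sigma_x^{-1}$ has $\ell_1$-norm at most $M_n$. Let $\hat\beta$ be a minimizer over $\beta\in\mathbb R^n$ of $$\frac1{2N}\|y-X\beta\|_2^2+\lambda_g\|\Delta^{(k+1)}\beta\|_1+\lambda\|\beta\|_1 .$$ Let $\Sigma_N=X^TX/N$, and let $\widehat\Theta$, a function of $X$ only, be a minimizer of $\sum_{a,b}|\Theta_{ab}|$ over all $\Theta\in\mathbb R^{n\times n}$ with $\max_{a,b}|(\Theta\Sigma_N-I_n)_{ab}|\le\mu$ (arbitrary if there is no such $\Theta$). Let $$\tilde\beta=\hat\beta+\frac1N\widehat\Theta X^T(y-X\hat\beta).$$ Then there is a constant $C_0>0$, depending only on $\sigma_x,c,c'$, such that the following holds for every constant $C_1$. Suppose that $$C_0\,\sigma_\varepsilon\sqrt{\tfrac{\log n}N}\le\lambda\le C_1\,\sigma_\varepsilon\sqrt{\tfrac{\log n}N},\qquad C_0\sqrt{\tfrac{\log n}N}\le\mu\le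 C_1\sqrt{\tfrac{\log n}N},$$ that $\lambda_g=\lambda\sqrt{\nu/(2d)^{k+1}}$ (the value of $\lambda_g$ is immaterial, and is taken to be $0$, if $\mathcal G$ has no edges), and that $s_2\log n/\sqrt N\to0$ and $M_n\sqrt{\log n/N}\to0$. Then, for every choice of $j=j_l\in\{1,\dots,n\}$, $$\frac{\sqrt N(\tilde\beta_j-\beta_j^*)}{\sigma_\varepsilon\sqrt{e_j^T\widehat\Theta\Sigma_N\widehat\Theta^Te_j}}\longrightarrow N(0,1)\quad\text{in distribution.}$$ Consequently, for every $\alpha\in(0,1)$, with $z=\Phi^{-1}(1-\alpha/2)$ and $\Phi$ the standard normal distribution function: (a) the interval with endpoints $\tilde\beta_j\pm z\,\sigma_\varepsilon\sqrt{e_j^T\widehat\Theta\Sigma_N\widehat\Theta^Te_j/N}$ contains $\beta^*_j$ with probability tending to $1-\alpha$; (b) if $\beta_j^*=0$ for all $l$, the probability that $\left|\sqrt N\tilde\beta_j\big/\bigl(\sigma_\varepsilon\sqrt{e_j^T\widehat\Theta\Sigma_N\widehat\Theta^Te_j}\bigr)\right|>z$ tends to $\alpha$. -/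

import Mathlib

open MeasureTheory ProbabilityTheory Filter Topology
open scoped Matrix

/-! ### Graph difference operators -/

/-- The edges `(i, j)`, `i < j`, of a graph on the vertices `0, …, n - 1`. -/
def GraphEdge {n : ℕ} (G : SimpleGraph (Fin n)) : Type :=
  {e : Fin n × Fin n // e.1 < e.2 ∧ G.Adj e.1 e.2}

noncomputable instance {n : ℕ} (G : SimpleGraph (Fin n)) : Fintype (GraphEdge G) :=
  haveI : Finite (GraphEdge G) := by unfold GraphEdge; infer_instance
  Fintype.ofFinite _

/-- The oriented incidence matrix: the row of the edge `(i, j)`, `i < j`, has the entry `-1` at `i`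
and `+1` at `j`. -/
def orientedIncidence {n : ℕ} (G : SimpleGraph (Fin n)) : Matrix (GraphEdge G) (Fin n) ℝ :=
  Matrix.of fun e v => if v = e.1.1 then -1 else if v = e.1.2 then 1 else 0

/-- The graph Laplacian `L = Fᵀ F`. -/
noncomputable def graphLaplacian {n : ℕ} (G : SimpleGraph (Fin n)) : Matrix (Fin n) (Fin n) ℝ :=
  (orientedIncidence G)ᵀ * orientedIncidence G

/-- The row index set of a graph difference operator `Δ^(k+1)`: edges if `k` is even (`true`),
nodes if `k` is odd (`false`). -/
def DiffRow {n : ℕ} (G : SimpleGraph (Fin n)) : Bool → Type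
  | true => GraphEdge G
  | false => Fin n

noncomputable instance {n : ℕ} (G : SimpleGraph (Fin n)) : (b : Bool) → Fintype (DiffRow G b)
  | true => inferInstanceAs (Fintype (GraphEdge G))
  | false => inferInstanceAs (Fintype (Fin n))

/-- The two closed forms of the graph difference operator of order `k + 1`. -/
noncomputable def graphDiffAux {n : ℕ} (G : SimpleGraph (Fin n)) (k : ℕ) :
    (b : Bool) → Matrix (DiffRow G b) (Fin n) ℝ
  | true => orientedIncidence G * graphLaplacian G ^ (k / 2)
  | false => graphLaplacian G ^ ((k + 1) / 2)

/-- The graph difference operator `Δ^(k+1)` of order `k + 1`: it is `F L^(k/2)` for even `k` and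
`L^((k+1)/2)` for odd `k`. -/
noncomputable def graphDiff {n : ℕ} (G : SimpleGraph (Fin n)) (k : ℕ) :
    Matrix (DiffRow G (decide (Even k))) (Fin n) ℝ :=
  graphDiffAux G k (decide (Even k))

open Classical in
/-- The maximum degree of the graph. -/
noncomputable def graphMaxDegree {n : ℕ} (G : SimpleGraph (Fin n)) : ℕ := G.maxDegree

/-- The `ℓ₁`-norm of a vector. -/
def vecL1 {ι : Type*} [Fintype ι] (v : ι → ℝ) : ℝ := ∑ i, |v i|

/-- The parameter space `S(k, s₁, s₂)`: `‖Δ^(k+1) β‖₀ ≤ s₁` and `‖β‖₀ ≤ s₂`. -/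
def paramSpace {n : ℕ} (G : SimpleGraph (Fin n)) (k s₁ s₂ : ℕ) : Set (Fin n → ℝ) :=
  {β | hammingNorm (graphDiff G k *ᵥ β) ≤ s₁ ∧ hammingNorm β ≤ s₂}

/-! ### The data -/

/-- A real random variable `Z` is `σ`-sub-Gaussian: it has mean zero and
`E exp (t Z) ≤ exp (σ² t² / 2)` for all real `t`. -/
def IsSubGaussian {Ω : Type*} [MeasurableSpace Ω] (σ : ℝ) (Z : Ω → ℝ) (P : Measure Ω) : Prop :=
  (Integrable Z P ∧ ∫ ω, Z ω ∂P = 0) ∧ HasSubgaussianMGF Z (σ ^ 2).toNNReal P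

/-- A random vector `V` is `σ`-sub-Gaussian: it has mean zero and `uᵀ V` is `σ`-sub-Gaussian for
every unit vector `u` of the Euclidean norm. -/
def IsSubGaussianVec {Ω : Type*} [MeasurableSpace Ω] {n : ℕ} (σ : ℝ) (V : Ω → Fin n → ℝ)
    (P : Measure Ω) : Prop :=
  (∀ a, Integrable (fun ω => V ω a) P ∧ ∫ ω, V ω a ∂P = 0) ∧
    ∀ u : Fin n → ℝ, ∑ a, u a ^ 2 = 1 → IsSubGaussian σ (fun ω => u ⬝ᵥ V ω) P

/-- `X` is a row-wise `(σ, S)`-sub-Gaussian random matrix: its rows are i.i.d. draws from a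
`σ`-sub-Gaussian distribution with covariance matrix `S`. -/
structure IsRowwiseSubGaussian {Ω : Type*} [MeasurableSpace Ω] {N n : ℕ} (σ : ℝ)
    (S : Matrix (Fin n) (Fin n) ℝ) (X : Ω → Fin N → Fin n → ℝ) (P : Measure Ω) : Prop where
  measurable : Measurable X
  indep : iIndepFun (fun (i : Fin N) ω => X ω i) P
  identDistrib : ∀ i i' : Fin N, IdentDistrib (fun ω => X ω i) (fun ω => X ω i') P P
  subGaussian : ∀ i : Fin N, IsSubGaussianVec σ (fun ω => X ω i) P
  covariance_eq : ∀ (i : Fin N) (a b : Fin n), cov[fun ω => X ω i a, fun ω => X ω i b; P] = S a b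

/-- `ε ∼ N(0, σ² I_N)`: the coordinates are i.i.d. normal with mean `0` and variance `σ²`. -/
structure IsGaussianNoise {Ω : Type*} [MeasurableSpace Ω] {N : ℕ} (σ : ℝ)
    (ε : Ω → Fin N → ℝ) (P : Measure Ω) : Prop where
  measurable : Measurable ε
  indep : iIndepFun (fun (i : Fin N) ω => ε ω i) P
  law : ∀ i : Fin N, P.map (fun ω => ε ω i) = gaussianReal 0 (σ ^ 2).toNNReal

/-- The response `y = X β* + ε` of the linear model. -/
def response {N n : ℕ} (X : Fin N → Fin n → ℝ) (β : Fin n → ℝ) (ε : Fin N → ℝ) : Fin N → ℝ :=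
  Matrix.of X *ᵥ β + ε

/-- `Σ_N = Xᵀ X / N`. -/
noncomputable def sampleCov {N n : ℕ} (X : Fin N → Fin n → ℝ) : Matrix (Fin n) (Fin n) ℝ :=
  (1 / (N : ℝ)) • ((Matrix.of X)ᵀ * Matrix.of X)

/-! ### The estimators -/

/-- The objective function of the `k`-th order Graph-Piecewise-Polynomial-Lasso:
`‖y - X β‖₂² / (2 N) + lamg ‖Δ^(k+1) β‖₁ + lam ‖β‖₁`. -/
noncomputable def gpplObjective {N n : ℕ} (G : SimpleGraph (Fin n)) (k : ℕ) (lamg lam : ℝ)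
    (X : Fin N → Fin n → ℝ) (y : Fin N → ℝ) (β : Fin n → ℝ) : ℝ :=
  1 / (2 * (N : ℝ)) * ∑ i, (y i - (Matrix.of X *ᵥ β) i) ^ 2
    + lamg * vecL1 (graphDiff G k *ᵥ β) + lam * vecL1 β

/-- `b` is a `k`-th order Graph-Piecewise-Polynomial-Lasso. -/
def IsGPPLasso {N n : ℕ} (G : SimpleGraph (Fin n)) (k : ℕ) (lamg lam : ℝ)
    (X : Fin N → Fin n → ℝ) (y : Fin N → ℝ) (b : Fin n → ℝ) : Prop :=
  IsMinOn (gpplObjective G k lamg lam X y) Set.univ b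

/-- The constraint `‖Θ S - I‖_∞ ≤ mu` (in the entrywise maximum norm) of the CLIME program. -/
def climeFeasible {n : ℕ} (S : Matrix (Fin n) (Fin n) ℝ) (mu : ℝ) :
    Set (Matrix (Fin n) (Fin n) ℝ) :=
  {Θ | ∀ a b, |(Θ * S - 1) a b| ≤ mu}

/-- `Θ` is a solution of the CLIME program: it minimizes the entrywise `ℓ₁`-norm over the
feasible matrices. -/
def IsCLIME {n : ℕ} (S : Matrix (Fin n) (Fin n) ℝ) (mu : ℝ)
    (Θ : Matrix (Fin n) (Fin n) ℝ) : Prop :=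
  Θ ∈ climeFeasible S mu ∧
    IsMinOn (fun T : Matrix (Fin n) (Fin n) ℝ => ∑ a, ∑ b, |T a b|) (climeFeasible S mu) Θ

/-- The one-step estimator `b + Θ Xᵀ (y - X b) / N`. -/
noncomputable def oneStep {N n : ℕ} (Θ : Matrix (Fin n) (Fin n) ℝ) (X : Fin N → Fin n → ℝ)
    (y : Fin N → ℝ) (b : Fin n → ℝ) : Fin n → ℝ :=
  b + (1 / (N : ℝ)) • (Θ *ᵥ ((Matrix.of X)ᵀ *ᵥ (y - Matrix.of X *ᵥ b)))

/-- `e_jᵀ Θ Σ_N Θᵀ e_j`. -/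
noncomputable def oneStepVar {N n : ℕ} (Θ : Matrix (Fin n) (Fin n) ℝ) (X : Fin N → Fin n → ℝ)
    (j : Fin n) : ℝ :=
  (Θ * sampleCov X * Θᵀ) j j

/-- The quantile function `Φ⁻¹` of the standard normal distribution. -/
noncomputable def stdNormalQuantile (q : ℝ) : ℝ := sInf {x : ℝ | q ≤ cdf (gaussianReal 0 1) x}

/-! ### Products of sub-Gaussian random variables -/

/-! The estimation error splits exactly (`oneStep_response_sub`): √N(β̃_j − β*_j) is (XΘ̂_j)ᵀε/√N
minus √N times the pairing of row j of Θ̂Σ_N − I with β̂ − β*. Write V = e_jᵀΘ̂Σ_NΘ̂ᵀe_j. Since Θ̂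
depends on X only and ε is Gaussian and independent of X, the first term divided by σ_ε√V is a unit
combination of standard normals given X; its conditional law is N(0,1) for every X with V > 0, so no
central limit theorem is needed. It remains to make the second term negligible and to bound V below.

The CLIME constraint bounds the second term by √N μ‖β̂ − β*‖₁. With an ℓ₁ error of order s₂λ this is
of order s₂ log n/√N, which tends to 0. The same constraint and Cauchy–Schwarz give (1 − μ)² ≤ V
(Σ_N)_jj (`one_sub_sq_le_oneStepVar_mul`).

The ℓ₁ error bound (`IsGPPLasso.vecL1_sub_le`) is the deterministic Lasso argument. The graph
penalty can gain at most λ_g√s₁‖Δ(β̂ − β*)‖₂, and ‖Δ‖² ≤ (2d)^(k+1) together with ν ≤ s₂/s₁ turns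
this into λ√s₂‖β̂ − β*‖₂, the order of the sparsity penalty. Curvature of Σ_N along β̂ − β* follows
from its entrywise closeness to Σ_x, because the error satisfies ‖·‖₁² ≤ 36 s₂‖·‖₂² and s₂√(log n/N)
→ 0.

The random inputs are entrywise bounds of order √(log n/N) on Σ_N − Σ_x, Θ_xΣ_N − I and Xᵀε/N. All
are averages of products of sub-Gaussian variables, handled by a Bernstein inequality
(`exists_isProductBernsteinConst`) and a union bound (`measureReal_compl_designEvent_le`). -/

theorem lintegral_exp_mul_gaussianReal (s : ℝ) :
    ∫⁻ g, ENNReal.ofReal (Real.exp (s * g)) ∂(gaussianReal 0 1)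
      = ENNReal.ofReal (Real.exp (s ^ 2 / 2)) := by
  rw [← ofReal_integral_eq_lintegral_ofReal (integrable_exp_mul_gaussianReal s)
    (Eventually.of_forall fun _ => (Real.exp_pos _).le)]
  have h := congrFun (mgf_id_gaussianReal (μ := 0) (v := 1)) s
  simp only [mgf, id] at h
  rw [h]
  simp

/-- Linearize the square with an auxiliary Gaussian g: exp(cU²) = E_g exp(√(2c) U g). After Tonelli,
the sub-Gaussian bound for U at fixed g gives exp(cg²). Working with `lintegral` avoids any
integrability assumption. -/
theorem lintegral_exp_sq_le_gaussianReal {Ω : Type*} [MeasurableSpace Ω] {P : Measure Ω}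
    [IsProbabilityMeasure P] {U : Ω → ℝ} (hU : HasSubgaussianMGF U 1 P) {c : ℝ} (hc : 0 ≤ c) :
    ∫⁻ ω, ENNReal.ofReal (Real.exp (c * U ω ^ 2)) ∂P
      ≤ ∫⁻ g, ENNReal.ofReal (Real.exp (c * g ^ 2)) ∂(gaussianReal 0 1) := by
  have hs : √(2 * c) ^ 2 = 2 * c := Real.sq_sqrt (by positivity)
  have hUm : AEMeasurable U P := hU.aemeasurable
  calc ∫⁻ ω, ENNReal.ofReal (Real.exp (c * U ω ^ 2)) ∂P
      = ∫⁻ ω, ∫⁻ g, ENNReal.ofReal (Real.exp (√(2 * c) * U ω * g)) ∂(gaussianReal 0 1) ∂P := by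
        refine lintegral_congr fun ω => ?_
        rw [lintegral_exp_mul_gaussianReal, mul_pow, hs]
        congr 2; ring
    _ = ∫⁻ g, ∫⁻ ω, ENNReal.ofReal (Real.exp (√(2 * c) * U ω * g)) ∂P ∂(gaussianReal 0 1) := by
        refine lintegral_lintegral_swap ?_
        have h1 : AEMeasurable (fun p : Ω × ℝ => U p.1) (P.prod (gaussianReal 0 1)) :=
          hUm.comp_fst
        have h2 : AEMeasurable (fun p : Ω × ℝ => p.2) (P.prod (gaussianReal 0 1)) := by fun_prop
        exact (Real.measurable_exp.comp_aemeasurable ((h1.const_mul _).mul h2)).ennreal_ofReal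
    _ ≤ ∫⁻ g, ENNReal.ofReal (Real.exp (c * g ^ 2)) ∂(gaussianReal 0 1) := by
        refine lintegral_mono fun g => ?_
        have hi := hU.integrable_exp_mul (√(2 * c) * g)
        have hm := hU.mgf_le (√(2 * c) * g)
        have he : ∀ ω, √(2 * c) * U ω * g = √(2 * c) * g * U ω := fun ω => by ring
        simp only [he]
        rw [← ofReal_integral_eq_lintegral_ofReal hi
          (Eventually.of_forall fun _ => (Real.exp_pos _).le)]
        refine ENNReal.ofReal_le_ofReal (hm.trans (le_of_eq ?_))
        rw [mul_pow, hs]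
        congr 1
        simp only [NNReal.coe_one]
        ring

/-- For x ≥ −1, multiply 1 − x ≤ e^(−x) by (1 + x)e^x. For x < −1, use e^x ≤ 1 and x + x² ≥ 0. -/
theorem exp_le_one_add_add_sq_mul_exp_abs (x : ℝ) :
    Real.exp x ≤ 1 + x + x ^ 2 * Real.exp |x| := by
  rcases le_or_gt (-1) x with h | h
  · have h1 : 1 - x ≤ Real.exp (-x) := Real.one_sub_le_exp_neg x
    have h2 : (1 - x ^ 2) * Real.exp x ≤ 1 + x := by
      have h3 : (1 + x) * (1 - x) ≤ (1 + x) * Real.exp (-x) :=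
        mul_le_mul_of_nonneg_left h1 (by linarith)
      have h4 := mul_le_mul_of_nonneg_right h3 (Real.exp_pos x).le
      rw [mul_assoc _ (Real.exp (-x)), ← Real.exp_add, neg_add_cancel, Real.exp_zero] at h4
      nlinarith
    have h5 : x ^ 2 * Real.exp x ≤ x ^ 2 * Real.exp |x| :=
      mul_le_mul_of_nonneg_left (Real.exp_le_exp.2 (le_abs_self x)) (sq_nonneg x)
    nlinarith
  · have h1 : Real.exp x ≤ 1 := Real.exp_le_one_iff.2 (by linarith)
    have h2 : 1 ≤ Real.exp |x| := Real.one_le_exp (abs_nonneg x)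
    nlinarith [mul_le_mul_of_nonneg_left h2 (sq_nonneg x)]

/-- The factor y² is absorbed by one extra exp(t₀|y|), so the remainder is t² times a quantity free
of t; taking expectations then gives a quadratic bound on the log-mgf near 0. -/
theorem exp_mul_le_of_abs_le {t t₀ y : ℝ} (ht₀ : 0 < t₀) (ht : |t| ≤ t₀) :
    Real.exp (t * y) ≤ 1 + t * y + 2 * t ^ 2 / t₀ ^ 2 * Real.exp (2 * t₀ * |y|) := by
  have h1 := exp_le_one_add_add_sq_mul_exp_abs (t * y)
  have h2 : |t * y| ≤ t₀ * |y| := by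
    rw [abs_mul]; exact mul_le_mul_of_nonneg_right ht (abs_nonneg y)
  have h3 : (t₀ * |y|) ^ 2 / 2 ≤ Real.exp (t₀ * |y|) := by
    have := Real.quadratic_le_exp_of_nonneg (x := t₀ * |y|) (by positivity)
    have : 0 ≤ t₀ * |y| := by positivity
    linarith
  have h4 : (t * y) ^ 2 = t ^ 2 / t₀ ^ 2 * (t₀ * |y|) ^ 2 := by
    rw [mul_pow, mul_pow, sq_abs]; field_simp
  have h5 : (t * y) ^ 2 * Real.exp |t * y|
      ≤ t ^ 2 / t₀ ^ 2 * (2 * Real.exp (t₀ * |y|)) * Real.exp (t₀ * |y|) := by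
    rw [h4]
    gcongr
    linarith
  have h6 : Real.exp (2 * t₀ * |y|) = Real.exp (t₀ * |y|) * Real.exp (t₀ * |y|) := by
    rw [← Real.exp_add]; congr 1; ring
  rw [h6]
  refine h1.trans (le_of_le_of_eq (add_le_add_right h5 _) ?_)
  ring

theorem mgf_mul_le_of_hasSubgaussianMGF {Ω : Type*} [MeasurableSpace Ω] {P : Measure Ω}
    [IsProbabilityMeasure P] {U W : Ω → ℝ} (hU : HasSubgaussianMGF U 1 P)
    (hW : HasSubgaussianMGF W 1 P) {t₀ : ℝ} (ht₀ : 0 < t₀)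
    (hg : Integrable (fun g : ℝ => Real.exp (2 * t₀ * g ^ 2)) (gaussianReal 0 1))
    {t : ℝ} (ht : |t| ≤ t₀) :
    Integrable (fun ω => Real.exp (t * (U ω * W ω))) P ∧
      mgf (fun ω => U ω * W ω) P t ≤ Real.exp (t * ∫ ω, U ω * W ω ∂P
        + 2 * (∫ g, Real.exp (2 * t₀ * g ^ 2) ∂(gaussianReal 0 1)) / t₀ ^ 2 * t ^ 2) := by
  set I := ∫ g, Real.exp (2 * t₀ * g ^ 2) ∂(gaussianReal 0 1) with hI
  have hUm : AEMeasurable U P := hU.aemeasurable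
  have hWm : AEMeasurable W P := hW.aemeasurable
  have key : ∀ {V : Ω → ℝ}, HasSubgaussianMGF V 1 P →
      Integrable (fun ω => Real.exp (2 * t₀ * V ω ^ 2)) P ∧
        ∫ ω, Real.exp (2 * t₀ * V ω ^ 2) ∂P ≤ I := by
    intro V hV
    have hVm : AEMeasurable V P := hV.aemeasurable
    have h1 := lintegral_exp_sq_le_gaussianReal hV (c := 2 * t₀) (by positivity)
    rw [← ofReal_integral_eq_lintegral_ofReal hg
      (Eventually.of_forall fun _ => (Real.exp_pos _).le)] at h1
    have hm : AEStronglyMeasurable (fun ω => Real.exp (2 * t₀ * V ω ^ 2)) P := by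
      apply AEMeasurable.aestronglyMeasurable; fun_prop
    have h2 : Integrable (fun ω => Real.exp (2 * t₀ * V ω ^ 2)) P := by
      refine ⟨hm, ?_⟩
      rw [hasFiniteIntegral_iff_ofReal (Eventually.of_forall fun _ => (Real.exp_pos _).le)]
      exact h1.trans_lt ENNReal.ofReal_lt_top
    refine ⟨h2, ?_⟩
    rw [← ofReal_integral_eq_lintegral_ofReal h2
      (Eventually.of_forall fun _ => (Real.exp_pos _).le)] at h1
    exact (ENNReal.ofReal_le_ofReal_iff (integral_nonneg fun _ => (Real.exp_pos _).le)).1 h1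
  obtain ⟨hUi, hUI⟩ := key hU
  obtain ⟨hWi, hWI⟩ := key hW
  -- AM–GM twice, in the exponent and for the product pq. This decouples U from W without
  -- independence, which matters because both may be functions of the same design row.
  have hpt : ∀ ω, Real.exp (2 * t₀ * |U ω * W ω|)
      ≤ 1 / 2 * (Real.exp (2 * t₀ * U ω ^ 2) + Real.exp (2 * t₀ * W ω ^ 2)) := by
    intro ω
    set p := Real.exp (t₀ * U ω ^ 2)
    set q := Real.exp (t₀ * W ω ^ 2)
    have h1 : Real.exp (2 * t₀ * U ω ^ 2) = p * p := by
      rw [← Real.exp_add]; congr 1; ring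
    have h2 : Real.exp (2 * t₀ * W ω ^ 2) = q * q := by
      rw [← Real.exp_add]; congr 1; ring
    have h3 : Real.exp (2 * t₀ * |U ω * W ω|) ≤ p * q := by
      rw [← Real.exp_add, Real.exp_le_exp, abs_mul]
      nlinarith [mul_nonneg ht₀.le (sq_nonneg (|U ω| - |W ω|)), sq_abs (U ω), sq_abs (W ω)]
    rw [h1, h2]
    nlinarith [sq_nonneg (p - q)]
  have hEi : Integrable (fun ω => Real.exp (2 * t₀ * |U ω * W ω|)) P := by
    refine Integrable.mono' ((hUi.add hWi).const_mul (1 / 2)) ?_ ?_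
    · apply AEMeasurable.aestronglyMeasurable
      have : AEMeasurable (fun ω => |U ω * W ω|) P := (hUm.mul hWm).abs
      fun_prop
    · filter_upwards with ω
      rw [Real.norm_of_nonneg (Real.exp_pos _).le]
      exact hpt ω
  have hEI : ∫ ω, Real.exp (2 * t₀ * |U ω * W ω|) ∂P ≤ I := by
    refine (integral_mono hEi ((hUi.add hWi).const_mul (1 / 2)) hpt).trans ?_
    rw [integral_const_mul]
    simp only [Pi.add_apply]
    rw [integral_add hUi hWi]
    linarith
  have hYi : Integrable (fun ω => U ω * W ω) P := by
    refine Integrable.mono' (hEi.const_mul (1 / (2 * t₀))) (hUm.mul hWm).aestronglyMeasurable ?_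
    filter_upwards with ω
    rw [Real.norm_eq_abs, div_mul_eq_mul_div, one_mul, le_div_iff₀ (by positivity)]
    have := Real.add_one_le_exp (2 * t₀ * |U ω * W ω|)
    linarith
  have hti : Integrable (fun ω => Real.exp (t * (U ω * W ω))) P := by
    refine Integrable.mono' hEi ?_ ?_
    · apply AEMeasurable.aestronglyMeasurable; fun_prop
    · filter_upwards with ω
      rw [Real.norm_of_nonneg (Real.exp_pos _).le, Real.exp_le_exp]
      have h1 : t * (U ω * W ω) ≤ |t| * |U ω * W ω| := by
        rw [← abs_mul]; exact le_abs_self _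
      have h2 : |t| * |U ω * W ω| ≤ t₀ * |U ω * W ω| :=
        mul_le_mul_of_nonneg_right ht (abs_nonneg _)
      have h3 : 0 ≤ t₀ * |U ω * W ω| := by positivity
      linarith
  refine ⟨hti, ?_⟩
  have hli : Integrable (fun ω => 1 + t * (U ω * W ω)) P :=
    (integrable_const 1).add (hYi.const_mul t)
  have h1 : mgf (fun ω => U ω * W ω) P t ≤ ∫ ω, (1 + t * (U ω * W ω)
      + 2 * t ^ 2 / t₀ ^ 2 * Real.exp (2 * t₀ * |U ω * W ω|)) ∂P :=
    integral_mono hti (hli.add (hEi.const_mul _))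
      fun ω => exp_mul_le_of_abs_le ht₀ ht
  rw [integral_add hli (hEi.const_mul _),
    integral_add (integrable_const 1) (hYi.const_mul t), integral_const_mul,
    integral_const_mul] at h1
  simp only [integral_const, probReal_univ, smul_eq_mul, mul_one] at h1
  have h2 : 2 * t ^ 2 / t₀ ^ 2 * ∫ ω, Real.exp (2 * t₀ * |U ω * W ω|) ∂P
      ≤ 2 * t ^ 2 / t₀ ^ 2 * I := mul_le_mul_of_nonneg_left hEI (by positivity)
  have h3 := Real.add_one_le_exp (t * ∫ ω, U ω * W ω ∂P + 2 * I / t₀ ^ 2 * t ^ 2)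
  have h4 : 2 * t ^ 2 / t₀ ^ 2 * I = 2 * I / t₀ ^ 2 * t ^ 2 := by ring
  linarith

theorem measureReal_sum_ge_le_of_mgf_le {Ω ι : Type*} [Fintype ι] [MeasurableSpace Ω]
    {P : Measure Ω} [IsProbabilityMeasure P] {Y : ι → Ω → ℝ} (hY : ∀ i, Measurable (Y i))
    (hind : iIndepFun Y P) {m K t₀ δ : ℝ} (hK : 0 < K)
    (hint : ∀ i t, |t| ≤ t₀ → Integrable (fun ω => Real.exp (t * Y i ω)) P)
    (hmgf : ∀ i t, |t| ≤ t₀ → mgf (Y i) P t ≤ Real.exp (t * m + K * t ^ 2))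
    (hδ : 0 ≤ δ) (hδt : δ ≤ 2 * K * t₀) :
    P.real {ω | Fintype.card ι * (m + δ) ≤ ∑ i, Y i ω}
      ≤ Real.exp (-(Fintype.card ι * δ ^ 2 / (4 * K))) := by
  -- The minimizer of K t² − tδ in the Chernoff bound; `hδt` is what keeps it within [−t₀, t₀].
  set t := δ / (2 * K) with ht
  have ht0 : 0 ≤ t := by positivity
  have htt : |t| ≤ t₀ := by
    rw [abs_of_nonneg ht0, ht, div_le_iff₀ (by positivity)]; linarith
  have hintS : Integrable (fun ω => Real.exp (t * (∑ i, Y i) ω)) P :=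
    iIndepFun.integrable_exp_mul_sum hind hY (s := Finset.univ) (fun i _ => hint i t htt)
  have h1 := measure_ge_le_exp_mul_mgf (Fintype.card ι * (m + δ)) ht0 hintS
  simp only [Finset.sum_apply] at h1
  refine h1.trans ?_
  rw [iIndepFun.mgf_sum hind hY Finset.univ]
  have h2 : ∏ i, mgf (Y i) P t ≤ ∏ _i : ι, Real.exp (t * m + K * t ^ 2) :=
    Finset.prod_le_prod (fun i _ => mgf_nonneg) fun i _ => hmgf i t htt
  refine (mul_le_mul_of_nonneg_left h2 (Real.exp_pos _).le).trans (le_of_eq ?_)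
  rw [Finset.prod_const, Finset.card_univ, ← Real.exp_nat_mul, ← Real.exp_add]
  congr 1
  rw [ht]
  field_simp
  ring

theorem hasSubgaussianMGF_div_one {Ω : Type*} [MeasurableSpace Ω] {P : Measure Ω}
    {U : Ω → ℝ} {σ : ℝ} (hσ : 0 < σ) (hU : HasSubgaussianMGF U (σ ^ 2).toNNReal P) :
    HasSubgaussianMGF (fun ω => U ω / σ) 1 P := by
  have h := hU.const_mul σ⁻¹
  convert h using 1
  · ext ω; rw [div_eq_inv_mul]
  · ext
    change (1 : ℝ) = σ⁻¹ ^ 2 * ((σ ^ 2).toNNReal : ℝ)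
    rw [Real.coe_toNNReal _ (sq_nonneg σ)]
    field_simp

/-- `A` and `B` are constants of a Bernstein inequality for averages of products of sub-Gaussian
random variables, at the scale `√(log n / N)`. -/
def IsProductBernsteinConst.{u} (A B : ℝ) : Prop :=
  ∀ {Ω : Type u} [MeasurableSpace Ω] (P : Measure Ω) [IsProbabilityMeasure P] (N n : ℕ)
    (U W : Fin N → Ω → ℝ) (σ τ m : ℝ), 0 < N → 2 ≤ n → Real.log n / N ≤ B → 0 < σ → 0 < τ →
    (∀ i, Measurable (U i)) → (∀ i, Measurable (W i)) →
    (∀ i, HasSubgaussianMGF (U i) (σ ^ 2).toNNReal P) →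
    (∀ i, HasSubgaussianMGF (W i) (τ ^ 2).toNNReal P) →
    iIndepFun (fun i ω => U i ω * W i ω) P → (∀ i, ∫ ω, U i ω * W i ω ∂P = m) →
    P.real {ω | σ * τ * A * √(Real.log n / N) < |1 / (N : ℝ) * ∑ i, U i ω * W i ω - m|}
      ≤ 2 / (n : ℝ) ^ 3

theorem exists_isProductBernsteinConst.{u} :
    ∃ A B : ℝ, 0 < A ∧ 0 < B ∧ IsProductBernsteinConst.{u} A B := by
  obtain ⟨c, hc, hci⟩ := IsGaussian.exists_integrable_exp_sq (gaussianReal 0 1)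
  set t₀ := c / 2 with ht₀
  have ht₀p : 0 < t₀ := by positivity
  have hg : Integrable (fun g : ℝ => Real.exp (2 * t₀ * g ^ 2)) (gaussianReal 0 1) := by
    have : 2 * t₀ = c := by rw [ht₀]; ring
    simpa only [this, Real.norm_eq_abs, sq_abs] using hci
  set K := 2 * (∫ g, Real.exp (2 * t₀ * g ^ 2) ∂(gaussianReal 0 1)) / t₀ ^ 2 with hKd
  have hK : 0 < K := by
    have h1 : 0 < ∫ g, Real.exp (2 * t₀ * g ^ 2) ∂(gaussianReal 0 1) := integral_exp_pos hg
    positivity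
  -- With δ = A√(log n/N) the exponent Nδ²/(4K) equals 3 log n. Tails of order n⁻³ survive a union
  -- over n² matrix entries. The bound B on log n/N below is the condition δ ≤ 2Kt₀.
  set A := √(12 * K) with hA
  have hAp : 0 < A := by positivity
  have hA2 : A ^ 2 = 12 * K := Real.sq_sqrt (by positivity)
  refine ⟨A, (2 * K * t₀ / A) ^ 2, hAp, by positivity, ?_⟩
  intro Ω _ P _ N n U W σ τ m hN hn hB hσ hτ hUm hWm hU hW hind hm
  have hN' : (0 : ℝ) < N := by exact_mod_cast hN
  have hn' : (0 : ℝ) < n := by positivity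
  have hlog : 0 ≤ Real.log n := Real.log_natCast_nonneg n
  set δ := A * √(Real.log n / N) with hδ
  have hδ0 : 0 ≤ δ := by positivity
  have hδt : δ ≤ 2 * K * t₀ := by
    have h1 : √(Real.log n / N) ≤ 2 * K * t₀ / A := by
      rw [← Real.sqrt_sq (show 0 ≤ 2 * K * t₀ / A by positivity)]
      exact Real.sqrt_le_sqrt hB
    rw [le_div_iff₀ hAp] at h1
    rw [hδ]; linarith
  have hexp : Real.exp (-(Fintype.card (Fin N) * δ ^ 2 / (4 * K))) = 1 / (n : ℝ) ^ 3 := by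
    have h1 : (Fintype.card (Fin N) : ℝ) * δ ^ 2 / (4 * K) = 3 * Real.log n := by
      rw [hδ, mul_pow, hA2, Real.sq_sqrt (by positivity), Fintype.card_fin]
      field_simp
      ring
    rw [h1, Real.exp_neg, one_div]
    congr 1
    rw [show (3 : ℝ) * Real.log n = Real.log n * (3 : ℕ) by push_cast; ring, mul_comm,
      Real.exp_nat_mul, Real.exp_log hn']
  set u : Fin N → Ω → ℝ := fun i ω => U i ω / σ
  set w : Fin N → Ω → ℝ := fun i ω => W i ω / τ
  have hu : ∀ i, HasSubgaussianMGF (u i) 1 P := fun i => hasSubgaussianMGF_div_one hσ (hU i)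
  have hw : ∀ i, HasSubgaussianMGF (w i) 1 P := fun i => hasSubgaussianMGF_div_one hτ (hW i)
  have huw : ∀ i ω, u i ω * w i ω = (σ * τ)⁻¹ * (U i ω * W i ω) := by
    intro i ω; simp only [u, w]; field_simp
  have hem : ∀ i, ∫ ω, u i ω * w i ω ∂P = (σ * τ)⁻¹ * m := by
    intro i
    simp only [huw]
    rw [integral_const_mul, hm i]
  have hi1 : iIndepFun (fun i ω => u i ω * w i ω) P := by
    have := hind.comp (fun _ x => (σ * τ)⁻¹ * x) (fun _ => by fun_prop)
    simpa only [huw, Function.comp_def] using this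
  have hi2 : iIndepFun (fun i ω => -(u i ω * w i ω)) P :=
    hi1.comp (fun _ x => -x) (fun _ => by fun_prop)
  have hmeas : ∀ i, Measurable (fun ω => u i ω * w i ω) := fun i =>
    ((hUm i).div_const σ).mul ((hWm i).div_const τ)
  have up := measureReal_sum_ge_le_of_mgf_le hmeas hi1 (m := (σ * τ)⁻¹ * m) (K := K) (t₀ := t₀)
    (δ := δ) hK (fun i t ht => (mgf_mul_le_of_hasSubgaussianMGF (hu i) (hw i) ht₀p hg ht).1)
    (fun i t ht => by
      have := (mgf_mul_le_of_hasSubgaussianMGF (hu i) (hw i) ht₀p hg ht).2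
      rwa [hem i] at this) hδ0 hδt
  have dn := measureReal_sum_ge_le_of_mgf_le (fun i => (hmeas i).neg) hi2
    (m := -((σ * τ)⁻¹ * m)) (K := K) (t₀ := t₀)
    (δ := δ) hK
    (fun i t ht => by
      have := (mgf_mul_le_of_hasSubgaussianMGF (hu i) (hw i) ht₀p hg (t := -t) (by rwa [abs_neg])).1
      simpa only [neg_mul, mul_neg, Pi.neg_apply] using this)
    (fun i t ht => by
      have := (mgf_mul_le_of_hasSubgaussianMGF (hu i) (hw i) ht₀p hg (t := -t) (by rwa [abs_neg])).2
      rw [hem i, ← mgf_neg] at this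
      have h2 : -t * ((σ * τ)⁻¹ * m) + K * (-t) ^ 2 = t * -((σ * τ)⁻¹ * m) + K * t ^ 2 := by ring
      rw [← h2]
      exact this) hδ0 hδt
  rw [hexp] at up dn
  have hsub : {ω | σ * τ * A * √(Real.log n / N) < |1 / (N : ℝ) * ∑ i, U i ω * W i ω - m|}
      ⊆ {ω | Fintype.card (Fin N) * ((σ * τ)⁻¹ * m + δ) ≤ ∑ i, u i ω * w i ω}
        ∪ {ω | Fintype.card (Fin N) * (-((σ * τ)⁻¹ * m) + δ) ≤ ∑ i, -(u i ω * w i ω)} := by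
    intro ω hω
    simp only [Set.mem_ofPred_eq] at hω
    have hst : 0 < σ * τ := by positivity
    have hS : ∑ i, u i ω * w i ω = (σ * τ)⁻¹ * ∑ i, U i ω * W i ω := by
      simp only [huw, Finset.mul_sum]
    simp only [Set.mem_union, Set.mem_ofPred_eq, Finset.sum_neg_distrib, hS, Fintype.card_fin]
    set T := ∑ i, U i ω * W i ω
    have e1 : (N : ℝ) * ((σ * τ)⁻¹ * m + δ) = (σ * τ)⁻¹ * (N * (m + σ * τ * δ)) := by
      field_simp
    have e2 : (N : ℝ) * (-((σ * τ)⁻¹ * m) + δ) = (σ * τ)⁻¹ * (N * (-m + σ * τ * δ)) := by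
      field_simp
    have e3 : -((σ * τ)⁻¹ * T) = (σ * τ)⁻¹ * (-T) := by ring
    have hδ' : σ * τ * A * √(Real.log n / N) = σ * τ * δ := by rw [hδ]; ring
    rw [hδ'] at hω
    rw [e1, e2, e3]
    have hTN : (1 / (N : ℝ) * T) * N = T := by field_simp
    rcases lt_abs.1 hω with h | h
    · left
      refine mul_le_mul_of_nonneg_left ?_ (inv_pos.2 hst).le
      nlinarith
    · right
      refine mul_le_mul_of_nonneg_left ?_ (inv_pos.2 hst).le
      nlinarith
  refine (measureReal_mono hsub (measure_ne_top _ _)).trans ((measureReal_union_le _ _).trans ?_)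
  calc _ ≤ 1 / (n : ℝ) ^ 3 + 1 / (n : ℝ) ^ 3 := add_le_add up dn
    _ = 2 / (n : ℝ) ^ 3 := by ring

/-! ### The graph difference operator -/

theorem dotProduct_self_eq_sum_sq {ι : Type*} [Fintype ι] (v : ι → ℝ) : v ⬝ᵥ v = ∑ i, v i ^ 2 := by
  simp [dotProduct, sq]

theorem orientedIncidence_mulVec {n : ℕ} (G : SimpleGraph (Fin n)) (v : Fin n → ℝ)
    (e : GraphEdge G) : (orientedIncidence G *ᵥ v) e = v e.1.2 - v e.1.1 := by
  have hne : e.1.1 ≠ e.1.2 := e.2.1.ne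
  have h : ∀ a, (if a = e.1.1 then (-1 : ℝ) else if a = e.1.2 then 1 else 0) * v a
      = (if a = e.1.2 then v a else 0) - (if a = e.1.1 then v a else 0) := by
    intro a
    by_cases h1 : a = e.1.1
    · have : a ≠ e.1.2 := h1 ▸ hne
      simp [h1, hne]
    · by_cases h2 : a = e.1.2 <;> simp [h1, h2, hne.symm]
  simp only [Matrix.mulVec, dotProduct, orientedIncidence, Matrix.of_apply, h,
    Finset.sum_sub_distrib, Finset.sum_ite_eq', Finset.mem_univ, if_true]

/-- Each edge costs (x − y)² ≤ 2(x² + y²), and a vertex is charged once per incident edge, hence at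
most d times. -/
theorem sum_sq_orientedIncidence_mulVec_le {n : ℕ} (G : SimpleGraph (Fin n)) (v : Fin n → ℝ) :
    ∑ e, (orientedIncidence G *ᵥ v) e ^ 2 ≤ 2 * (graphMaxDegree G : ℝ) * ∑ a, v a ^ 2 := by
  classical
  have h1 : ∑ e, (orientedIncidence G *ᵥ v) e ^ 2
      ≤ ∑ e : GraphEdge G, 2 * (v e.1.1 ^ 2 + v e.1.2 ^ 2) := by
    refine Finset.sum_le_sum fun e _ => ?_
    rw [orientedIncidence_mulVec]
    nlinarith [sq_nonneg (v e.1.2 + v e.1.1)]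
  have h2 : ∀ f : Fin n × Fin n → ℝ, ∑ e : GraphEdge G, f e.1
      = ∑ p ∈ Finset.univ.filter (fun p : Fin n × Fin n => p.1 < p.2 ∧ G.Adj p.1 p.2), f p := by
    intro f
    refine Finset.sum_bij (fun e _ => e.1) (fun e _ => ?_) (fun e _ e' _ h => Subtype.ext h)
      (fun p hp => ?_) (fun e _ => rfl)
    · exact Finset.mem_filter.2 ⟨Finset.mem_univ _, e.2⟩
    · exact ⟨⟨p, (Finset.mem_filter.1 hp).2⟩, Finset.mem_univ _, rfl⟩
  have h3 : ∑ e : GraphEdge G, 2 * (v e.1.1 ^ 2 + v e.1.2 ^ 2)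
      = 2 * ∑ a, ∑ b, if G.Adj a b then v a ^ 2 else 0 := by
    rw [← Finset.mul_sum]
    congr 1
    rw [h2 (fun p => v p.1 ^ 2 + v p.2 ^ 2), Finset.sum_add_distrib, Finset.sum_filter,
      Finset.sum_filter, Fintype.sum_prod_type, Fintype.sum_prod_type_right,
      ← Finset.sum_add_distrib]
    refine Finset.sum_congr rfl fun a _ => ?_
    rw [← Finset.sum_add_distrib]
    refine Finset.sum_congr rfl fun b _ => ?_
    simp only
    rcases lt_trichotomy a b with h | h | h
    · simp [h, h.not_gt]
    · simp [h]
    · simp [h, h.not_gt, G.adj_comm b a]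
  have h4 : ∀ a, ∑ b, (if G.Adj a b then v a ^ 2 else 0) = (G.degree a : ℝ) * v a ^ 2 := by
    intro a
    rw [← Finset.sum_filter, Finset.sum_const, nsmul_eq_mul, ← G.card_neighborFinset_eq_degree]
    congr 3
    ext b; simp
  have h5 : ∀ a, (G.degree a : ℝ) ≤ graphMaxDegree G := by
    intro a
    have : G.degree a ≤ graphMaxDegree G := by
      unfold graphMaxDegree
      convert G.degree_le_maxDegree a
    exact_mod_cast this
  refine h1.trans (h3.le.trans ?_)
  rw [mul_assoc, Finset.mul_sum Finset.univ _ (graphMaxDegree G : ℝ)]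
  refine mul_le_mul_of_nonneg_left (Finset.sum_le_sum fun a _ => ?_) (by norm_num)
  rw [h4]
  exact mul_le_mul_of_nonneg_right (h5 a) (sq_nonneg _)

/-- ‖Lv‖² = ⟨F Lv, F v⟩, so Cauchy–Schwarz and the bound on F give ‖Lv‖⁴ ≤ (2d)²‖Lv‖²‖v‖²; one
factor ‖Lv‖² cancels. -/
theorem sum_sq_graphLaplacian_mulVec_le {n : ℕ} (G : SimpleGraph (Fin n)) (v : Fin n → ℝ) :
    ∑ a, (graphLaplacian G *ᵥ v) a ^ 2
      ≤ (2 * (graphMaxDegree G : ℝ)) ^ 2 * ∑ a, v a ^ 2 := by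
  set D : ℝ := 2 * (graphMaxDegree G : ℝ)
  have hD : 0 ≤ D := by positivity
  set F := orientedIncidence G
  set w := F *ᵥ v
  set x := graphLaplacian G *ᵥ v with hx
  have hxw : x = Fᵀ *ᵥ w := by
    rw [hx, graphLaplacian, ← Matrix.mulVec_mulVec]
  have e1 : ∑ a, x a ^ 2 = (F *ᵥ x) ⬝ᵥ w := by
    have e0 : x ⬝ᵥ x = x ⬝ᵥ (Fᵀ *ᵥ w) := by rw [← hxw]
    rw [← dotProduct_self_eq_sum_sq, e0, Matrix.dotProduct_mulVec, Matrix.vecMul_transpose]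
  have e2 : ((F *ᵥ x) ⬝ᵥ w) ^ 2 ≤ (∑ e, (F *ᵥ x) e ^ 2) * ∑ e, w e ^ 2 :=
    Finset.sum_mul_sq_le_sq_mul_sq _ _ _
  have e3 := sum_sq_orientedIncidence_mulVec_le G x
  have e4 := sum_sq_orientedIncidence_mulVec_le G v
  set Q := ∑ a, x a ^ 2
  set R := ∑ a, v a ^ 2
  have hQ : 0 ≤ Q := Finset.sum_nonneg fun _ _ => sq_nonneg _
  have hR : 0 ≤ R := Finset.sum_nonneg fun _ _ => sq_nonneg _
  have e5 : Q ^ 2 ≤ (D * Q) * (D * R) := by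
    conv_lhs => rw [e1]
    refine e2.trans (mul_le_mul e3 e4 (Finset.sum_nonneg fun _ _ => sq_nonneg _) (by positivity))
  rcases hQ.eq_or_lt with h | h
  · rw [← h]; positivity
  · nlinarith

theorem sum_sq_graphDiff_mulVec_le {n : ℕ} (G : SimpleGraph (Fin n)) (k : ℕ) (v : Fin n → ℝ) :
    ∑ r, (graphDiff G k *ᵥ v) r ^ 2
      ≤ (2 * (graphMaxDegree G : ℝ)) ^ (k + 1) * ∑ a, v a ^ 2 := by
  set D : ℝ := 2 * (graphMaxDegree G : ℝ) with hD
  have hD0 : 0 ≤ D := by positivity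
  have hpow : ∀ m : ℕ, ∑ a, ((graphLaplacian G ^ m) *ᵥ v) a ^ 2 ≤ D ^ (2 * m) * ∑ a, v a ^ 2 := by
    intro m
    induction m with
    | zero => simp
    | succ m ih =>
      rw [pow_succ', ← Matrix.mulVec_mulVec]
      refine (sum_sq_graphLaplacian_mulVec_le G _).trans ?_
      refine (mul_le_mul_of_nonneg_left ih (by positivity)).trans (le_of_eq ?_)
      rw [← hD]; ring
  -- The row type depends on the Boolean `decide (Even k)`; with a free `b` tied to it by an
  -- equation the parity split is well typed.
  have key : ∀ b : Bool, b = decide (Even k) →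
      ∑ r, (graphDiffAux G k b *ᵥ v) r ^ 2 ≤ D ^ (k + 1) * ∑ a, v a ^ 2 := by
    intro b hb
    cases b with
    | true =>
      have hk : Even k := by simpa using hb.symm
      have hk2 : 2 * (k / 2) = k := Nat.two_mul_div_two_of_even hk
      change ∑ r, ((orientedIncidence G * graphLaplacian G ^ (k / 2)) *ᵥ v) r ^ 2 ≤ _
      rw [← Matrix.mulVec_mulVec]
      refine (sum_sq_orientedIncidence_mulVec_le G _).trans ?_
      refine (mul_le_mul_of_nonneg_left (hpow (k / 2)) (by positivity)).trans (le_of_eq ?_)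
      rw [hk2, ← hD]; ring
    | false =>
      have hk : ¬ Even k := by simpa using hb.symm
      have hk2 : 2 * ((k + 1) / 2) = k + 1 :=
        Nat.two_mul_div_two_of_even ((Nat.not_even_iff_odd.1 hk).add_one)
      have := hpow ((k + 1) / 2)
      rwa [hk2] at this
  exact key _ rfl

/-! ### Deterministic bound for the estimation error -/

theorem sum_abs_le_sqrt_mul_sqrt {ι : Type*} [Fintype ι] (T : Finset ι) (v : ι → ℝ) (s : ℕ)
    (hs : T.card ≤ s) : ∑ i ∈ T, |v i| ≤ √s * √(∑ i, v i ^ 2) := by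
  have hcard : (T.card : ℝ) ≤ s := by exact_mod_cast hs
  rw [← Real.sqrt_mul (by positivity)]
  refine Real.le_sqrt_of_sq_le ((sq_sum_le_card_mul_sum_sq (s := T) (f := fun i => |v i|)).trans ?_)
  simp only [sq_abs]
  refine mul_le_mul hcard ?_ (Finset.sum_nonneg fun _ _ => sq_nonneg _) (by positivity)
  exact Finset.sum_le_univ_sum_of_nonneg fun _ => sq_nonneg _

/-- Off the support of v a coordinate contributes −|w i| ≤ 0, so only s coordinates count and
Cauchy–Schwarz applies. This serves the graph penalty. -/
theorem vecL1_sub_vecL1_le {ι : Type*} [Fintype ι] (v w : ι → ℝ) (s : ℕ)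
    (hs : hammingNorm v ≤ s) : vecL1 v - vecL1 w ≤ √s * √(∑ i, (w i - v i) ^ 2) := by
  classical
  refine le_trans ?_ (sum_abs_le_sqrt_mul_sqrt (Finset.univ.filter fun i => v i ≠ 0)
    (fun i => w i - v i) s (by convert hs; unfold hammingNorm; congr 1))
  unfold vecL1
  rw [← Finset.sum_sub_distrib, Finset.sum_filter]
  refine Finset.sum_le_sum fun i _ => ?_
  by_cases h : v i = 0
  · simp [h]
  · simp only [ne_eq, h, not_false_eq_true, if_true]
    have := abs_sub_abs_le_abs_sub (v i) (w i)
    rwa [abs_sub_comm] at this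

/-- Off the support of v the terms −|w i| and |w i − v i| cancel; on it each coordinate contributes
at most 2|w i − v i|. The extra ℓ₁ term later absorbs the noise. -/
theorem vecL1_sub_vecL1_add_vecL1_sub_le {ι : Type*} [Fintype ι] (v w : ι → ℝ) (s : ℕ)
    (hs : hammingNorm v ≤ s) :
    vecL1 v - vecL1 w + vecL1 (w - v) ≤ 2 * (√s * √(∑ i, (w i - v i) ^ 2)) := by
  classical
  refine le_trans ?_ (mul_le_mul_of_nonneg_left
    (sum_abs_le_sqrt_mul_sqrt (Finset.univ.filter fun i => v i ≠ 0)
    (fun i => w i - v i) s (by convert hs; unfold hammingNorm; congr 1)) zero_le_two)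
  unfold vecL1
  rw [← Finset.sum_sub_distrib, ← Finset.sum_add_distrib, Finset.mul_sum, Finset.sum_filter]
  refine Finset.sum_le_sum fun i _ => ?_
  by_cases h : v i = 0
  · simp [h]
  · simp only [ne_eq, h, not_false_eq_true, if_true, Pi.sub_apply]
    have := abs_sub_abs_le_abs_sub (v i) (w i)
    rw [abs_sub_comm] at this
    linarith

theorem abs_dotProduct_mulVec_le {ι : Type*} [Fintype ι] (A : Matrix ι ι ℝ) (v : ι → ℝ) {κ : ℝ}
    (hA : ∀ a b, |A a b| ≤ κ) : |v ⬝ᵥ (A *ᵥ v)| ≤ κ * vecL1 v ^ 2 := by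
  have h1 : v ⬝ᵥ (A *ᵥ v) = ∑ a, ∑ b, v a * (A a b * v b) := by
    simp only [dotProduct, Matrix.mulVec, Finset.mul_sum]
  have h2 : κ * vecL1 v ^ 2 = ∑ a, ∑ b, |v a| * (κ * |v b|) := by
    rw [vecL1, sq, Finset.sum_mul_sum, Finset.mul_sum]
    refine Finset.sum_congr rfl fun a _ => ?_
    rw [Finset.mul_sum]
    exact Finset.sum_congr rfl fun b _ => by ring
  rw [h1, h2]
  refine (Finset.abs_sum_le_sum_abs _ _).trans (Finset.sum_le_sum fun a _ => ?_)
  refine (Finset.abs_sum_le_sum_abs _ _).trans (Finset.sum_le_sum fun b _ => ?_)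
  rw [abs_mul, abs_mul]
  exact mul_le_mul_of_nonneg_left (mul_le_mul_of_nonneg_right (hA a b) (abs_nonneg _))
    (abs_nonneg _)

theorem dotProduct_sampleCov_mulVec {N n : ℕ} (X : Fin N → Fin n → ℝ) (v : Fin n → ℝ) :
    v ⬝ᵥ (sampleCov X *ᵥ v) = 1 / (N : ℝ) * ∑ i, (Matrix.of X *ᵥ v) i ^ 2 := by
  rw [sampleCov, Matrix.smul_mulVec, dotProduct_smul, ← Matrix.mulVec_mulVec,
    Matrix.dotProduct_mulVec, Matrix.vecMul_transpose, dotProduct_self_eq_sum_sq, smul_eq_mul]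

/-- Compare the objective at b and at the true parameter; the residual at b is ε − X(b − β*), and
‖ε‖² cancels. -/
theorem IsGPPLasso.basic_inequality {N n : ℕ} {G : SimpleGraph (Fin n)} {k : ℕ} {lamg lam : ℝ}
    {X : Fin N → Fin n → ℝ} {βs b : Fin n → ℝ} {ε : Fin N → ℝ}
    (hb : IsGPPLasso G k lamg lam X (response X βs ε) b) :
    (b - βs) ⬝ᵥ (sampleCov X *ᵥ (b - βs)) / 2
      ≤ 1 / (N : ℝ) * ∑ i, ε i * (Matrix.of X *ᵥ (b - βs)) i
        + lamg * (vecL1 (graphDiff G k *ᵥ βs) - vecL1 (graphDiff G k *ᵥ b))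
        + lam * (vecL1 βs - vecL1 b) := by
  have h := isMinOn_univ_iff.1 hb βs
  simp only [gpplObjective] at h
  have e1 : ∀ i, response X βs ε i - (Matrix.of X *ᵥ b) i
      = ε i - (Matrix.of X *ᵥ (b - βs)) i := by
    intro i
    simp only [response, Matrix.mulVec_sub, Pi.add_apply, Pi.sub_apply]; ring
  have e2 : ∀ i, response X βs ε i - (Matrix.of X *ᵥ βs) i = ε i := by
    intro i
    simp only [response, Pi.add_apply]; ring
  simp only [e1, e2] at h
  have e3 : ∑ i, (ε i - (Matrix.of X *ᵥ (b - βs)) i) ^ 2 = ∑ i, ε i ^ 2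
      - 2 * ∑ i, ε i * (Matrix.of X *ᵥ (b - βs)) i + ∑ i, (Matrix.of X *ᵥ (b - βs)) i ^ 2 := by
    rw [Finset.mul_sum, ← Finset.sum_sub_distrib, ← Finset.sum_add_distrib]
    exact Finset.sum_congr rfl fun i _ => by ring
  rw [e3] at h
  rw [dotProduct_sampleCov_mulVec]
  have e4 : 1 / (2 * (N : ℝ)) = 1 / (N : ℝ) / 2 := by rw [mul_comm, div_mul_eq_div_div]
  rw [e4] at h
  linarith

theorem IsGPPLasso.vecL1_sub_le {N n : ℕ} {G : SimpleGraph (Fin n)} {k s₁ s₂ : ℕ}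
    {lamg lam ν c κ : ℝ} {X : Fin N → Fin n → ℝ} {βs b : Fin n → ℝ} {ε : Fin N → ℝ}
    {S : Matrix (Fin n) (Fin n) ℝ}
    (hb : IsGPPLasso G k lamg lam X (response X βs ε) b) (hlam : 0 < lam) (hc : 0 < c)
    (hs₁ : 0 < s₁) (hβ : βs ∈ paramSpace G k s₁ s₂) (hν : 0 ≤ ν) (hνs : ν ≤ (s₂ : ℝ) / s₁)
    (hlamg : lamg = lam * √(ν / (2 * (graphMaxDegree G : ℝ)) ^ (k + 1)))
    (hε : ∀ a, |1 / (N : ℝ) * ∑ i, X i a * ε i| ≤ lam / 2)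
    (hS : ∀ v, c * ∑ a, v a ^ 2 ≤ v ⬝ᵥ (S *ᵥ v)) (hκ : 0 ≤ κ)
    (hcov : ∀ a a', |(sampleCov X - S) a a'| ≤ κ) (hκs : 36 * s₂ * κ ≤ c / 2) :
    vecL1 (b - βs) ≤ 72 / c * s₂ * lam := by
  set Δ := b - βs with hΔ
  set r := √(∑ a, Δ a ^ 2) with hr
  have hr0 : 0 ≤ r := Real.sqrt_nonneg _
  have hr2 : r ^ 2 = ∑ a, Δ a ^ 2 := Real.sq_sqrt (Finset.sum_nonneg fun _ _ => sq_nonneg _)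
  have hrΔ : √(∑ a, (b a - βs a) ^ 2) = r := rfl
  set q := Δ ⬝ᵥ (sampleCov X *ᵥ Δ) with hq
  have hq0 : 0 ≤ q := by
    rw [hq, dotProduct_sampleCov_mulVec]
    exact mul_nonneg (by positivity) (Finset.sum_nonneg fun _ _ => sq_nonneg _)
  have hL0 : 0 ≤ vecL1 Δ := Finset.sum_nonneg fun _ _ => abs_nonneg _
  have hbasic := hb.basic_inequality
  have hnoise : 1 / (N : ℝ) * ∑ i, ε i * (Matrix.of X *ᵥ Δ) i ≤ lam / 2 * vecL1 Δ := by
    have h1 : 1 / (N : ℝ) * ∑ i, ε i * (Matrix.of X *ᵥ Δ) i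
        = ∑ a, (1 / (N : ℝ) * ∑ i, X i a * ε i) * Δ a := by
      simp only [Matrix.mulVec, dotProduct, Matrix.of_apply, Finset.mul_sum, Finset.sum_mul]
      rw [Finset.sum_comm]
      exact Finset.sum_congr rfl fun a _ => Finset.sum_congr rfl fun i _ => by ring
    rw [h1, vecL1, Finset.mul_sum]
    refine Finset.sum_le_sum fun a _ => (le_abs_self _).trans ?_
    rw [abs_mul]
    exact mul_le_mul_of_nonneg_right (hε a) (abs_nonneg _)
  set E : ℝ := (2 * (graphMaxDegree G : ℝ)) ^ (k + 1) with hE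
  have hE0 : 0 ≤ E := by positivity
  have hgraph : lamg * (vecL1 (graphDiff G k *ᵥ βs) - vecL1 (graphDiff G k *ᵥ b))
      ≤ lam * (√s₂ * r) := by
    have h1 := vecL1_sub_vecL1_le (graphDiff G k *ᵥ βs) (graphDiff G k *ᵥ b) s₁ hβ.1
    have h2 : ∑ i, ((graphDiff G k *ᵥ b) i - (graphDiff G k *ᵥ βs) i) ^ 2 ≤ E * r ^ 2 := by
      have := sum_sq_graphDiff_mulVec_le G k Δ
      rw [hr2]
      simpa only [hΔ, Matrix.mulVec_sub, Pi.sub_apply] using this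
    have h3 : √(ν / E) * (√s₁ * √(E * r ^ 2)) ≤ √s₂ * r := by
      rw [← Real.sqrt_mul (by positivity), ← Real.sqrt_mul (by positivity)]
      refine Real.sqrt_le_iff.2 ⟨by positivity, ?_⟩
      rw [mul_pow, Real.sq_sqrt (Nat.cast_nonneg s₂)]
      -- In a graph without edges E = 0, and division by zero makes both ν/E and `lamg` vanish;
      -- hence an inequality rather than an equality.
      have h4 : ν / E * E ≤ ν := by
        rcases hE0.eq_or_lt with h | h
        · rw [← h]; simpa using hν
        · rw [div_mul_cancel₀ _ h.ne']
      have h5 : ν * s₁ ≤ s₂ := by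
        rwa [le_div_iff₀ (by exact_mod_cast hs₁)] at hνs
      calc ν / E * (s₁ * (E * r ^ 2)) = (ν / E * E) * (s₁ * r ^ 2) := by ring
        _ ≤ ν * (s₁ * r ^ 2) := mul_le_mul_of_nonneg_right h4 (by positivity)
        _ = ν * s₁ * r ^ 2 := by ring
        _ ≤ s₂ * r ^ 2 := mul_le_mul_of_nonneg_right h5 (by positivity)
    have hlamg0 : 0 ≤ lamg := by rw [hlamg]; positivity
    calc lamg * (vecL1 (graphDiff G k *ᵥ βs) - vecL1 (graphDiff G k *ᵥ b))
        ≤ lamg * (√s₁ * √(E * r ^ 2)) := mul_le_mul_of_nonneg_left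
          (h1.trans (mul_le_mul_of_nonneg_left (Real.sqrt_le_sqrt h2) (by positivity))) hlamg0
      _ = lam * (√(ν / E) * (√s₁ * √(E * r ^ 2))) := by rw [hlamg]; ring
      _ ≤ lam * (√s₂ * r) := mul_le_mul_of_nonneg_left h3 hlam.le
  have hsparse := vecL1_sub_vecL1_add_vecL1_sub_le βs b s₂ hβ.2
  rw [hrΔ, ← hΔ] at hsparse
  -- The sparsity penalty contributes 2 and the graph penalty 1 to the constant 3; half of the ℓ₁
  -- term is spent on the noise. Dropping either summand on the left gives `hL` and `hq1`.
  have hmain : q / 2 + lam / 2 * vecL1 Δ ≤ 3 * lam * (√s₂ * r) := by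
    have := mul_le_mul_of_nonneg_left hsparse hlam.le
    linarith
  have hL : vecL1 Δ ≤ 6 * (√s₂ * r) := by
    have : lam * vecL1 Δ ≤ lam * (6 * (√s₂ * r)) := by linarith
    exact le_of_mul_le_mul_left this hlam
  have hq1 : q ≤ 6 * lam * (√s₂ * r) := by
    have : 0 ≤ lam / 2 * vecL1 Δ := by positivity
    linarith
  have hss : √(s₂ : ℝ) ^ 2 = s₂ := Real.sq_sqrt (by positivity)
  -- Restricted eigenvalue bound: replacing S by the sample covariance costs at most κ‖Δ‖₁² ≤ 36 s₂κ
  -- r², half of the curvature c r².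
  have hre : c / 2 * r ^ 2 ≤ q := by
    have h1 := abs_dotProduct_mulVec_le (sampleCov X - S) Δ hcov
    rw [Matrix.sub_mulVec, dotProduct_sub, ← hq] at h1
    have h2 := neg_le_of_abs_le h1
    have h3 := hS Δ
    rw [← hr2] at h3
    have h4 : vecL1 Δ ^ 2 ≤ 36 * s₂ * r ^ 2 := by
      calc vecL1 Δ ^ 2 ≤ (6 * (√s₂ * r)) ^ 2 := pow_le_pow_left₀ hL0 hL 2
        _ = 36 * s₂ * r ^ 2 := by rw [mul_pow, mul_pow, hss]; ring
    have h5 : κ * vecL1 Δ ^ 2 ≤ c / 2 * r ^ 2 := by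
      calc κ * vecL1 Δ ^ 2 ≤ κ * (36 * s₂ * r ^ 2) := mul_le_mul_of_nonneg_left h4 hκ
        _ = 36 * s₂ * κ * r ^ 2 := by ring
        _ ≤ c / 2 * r ^ 2 := mul_le_mul_of_nonneg_right hκs (sq_nonneg r)
    linarith
  have hrle : c * r ≤ 12 * lam * √s₂ := by
    rcases hr0.eq_or_lt with h | h
    · rw [← h]; simp only [mul_zero]; positivity
    · have h1 : r * (c * r) ≤ r * (12 * lam * √s₂) := by nlinarith
      exact le_of_mul_le_mul_left h1 h
  have hfin : c * vecL1 Δ ≤ 72 * s₂ * lam := by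
    calc c * vecL1 Δ ≤ c * (6 * (√s₂ * r)) := mul_le_mul_of_nonneg_left hL hc.le
      _ = 6 * √s₂ * (c * r) := by ring
      _ ≤ 6 * √s₂ * (12 * lam * √s₂) := mul_le_mul_of_nonneg_left hrle (by positivity)
      _ = 72 * √s₂ ^ 2 * lam := by ring
      _ = 72 * s₂ * lam := by rw [hss]
  rw [div_mul_eq_mul_div, div_mul_eq_mul_div, le_div_iff₀ hc]
  linarith

/-! ### The population covariance matrix and its inverse -/

/-- S − c and c' − S are Hermitian with nonnegative spectrum, hence positive semidefinite. -/
theorem dotProduct_mulVec_mem_Icc_of_spectrum_subset {n : ℕ} {S : Matrix (Fin n) (Fin n) ℝ}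
    (hS : S.IsHermitian) {c c' : ℝ} (hspec : spectrum ℝ S ⊆ Set.Icc c c') (v : Fin n → ℝ) :
    c * ∑ a, v a ^ 2 ≤ v ⬝ᵥ (S *ᵥ v) ∧ v ⬝ᵥ (S *ᵥ v) ≤ c' * ∑ a, v a ^ 2 := by
  have hdiag : ∀ r : ℝ, v ⬝ᵥ ((algebraMap ℝ (Matrix (Fin n) (Fin n) ℝ) r) *ᵥ v)
      = r * ∑ a, v a ^ 2 := by
    intro r
    rw [Algebra.algebraMap_eq_smul_one, Matrix.smul_mulVec, Matrix.one_mulVec, dotProduct_smul,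
      dotProduct_self_eq_sum_sq, smul_eq_mul]
  have hherm : ∀ r : ℝ, (algebraMap ℝ (Matrix (Fin n) (Fin n) ℝ) r).IsHermitian := by
    intro r
    rw [Algebra.algebraMap_eq_smul_one]
    exact Matrix.isHermitian_one.smul (IsSelfAdjoint.all r)
  constructor
  · have h : (S - algebraMap ℝ _ c).PosSemidef := by
      refine Matrix.posSemidef_iff_isHermitian_and_spectrum_nonneg.2 ⟨hS.sub (hherm c), ?_⟩
      rw [← spectrum.sub_singleton_eq]
      rintro x ⟨y, hy, z, hz, rfl⟩
      rw [Set.mem_singleton_iff] at hz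
      have := (hspec hy).1
      simp only [Set.mem_ofPred_eq, hz]
      linarith
    have h2 := h.dotProduct_mulVec_nonneg v
    rw [Matrix.sub_mulVec, dotProduct_sub, star_trivial, hdiag] at h2
    linarith
  · have h : (algebraMap ℝ _ c' - S).PosSemidef := by
      refine Matrix.posSemidef_iff_isHermitian_and_spectrum_nonneg.2 ⟨(hherm c').sub hS, ?_⟩
      rw [← spectrum.singleton_sub_eq]
      rintro x ⟨z, hz, y, hy, rfl⟩
      rw [Set.mem_singleton_iff] at hz
      have := (hspec hy).2
      simp only [Set.mem_ofPred_eq, hz]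
      linarith
    have h2 := h.dotProduct_mulVec_nonneg v
    rw [Matrix.sub_mulVec, dotProduct_sub, star_trivial, hdiag] at h2
    linarith

theorem diag_le_of_spectrum_subset {n : ℕ} {S : Matrix (Fin n) (Fin n) ℝ}
    (hS : S.IsHermitian) {c c' : ℝ} (hspec : spectrum ℝ S ⊆ Set.Icc c c') (a : Fin n) :
    S a a ≤ c' := by
  have h := (dotProduct_mulVec_mem_Icc_of_spectrum_subset hS hspec (Pi.single a 1)).2
  simpa [Pi.single_apply] using h

theorem inv_mul_of_spectrum_subset {n : ℕ} {S : Matrix (Fin n) (Fin n) ℝ} {c c' : ℝ} (hc : 0 < c)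
    (hspec : spectrum ℝ S ⊆ Set.Icc c c') : S⁻¹ * S = 1 := by
  have h0 : (0 : ℝ) ∉ spectrum ℝ S := fun h => absurd (hspec h).1 (not_le.2 hc)
  have hu : IsUnit S := spectrum.zero_notMem_iff ℝ |>.1 h0
  exact Matrix.nonsing_inv_mul S ((Matrix.isUnit_iff_isUnit_det S).1 hu)

/-- For the row v = e_aᵀS⁻¹ one has vᵀS = e_aᵀ, so c‖v‖² ≤ vᵀSv = v_a ≤ ‖v‖. Thus v ⬝ X_i is
sub-Gaussian with parameter σ/c. -/
theorem sum_sq_inv_row_le {n : ℕ} {S : Matrix (Fin n) (Fin n) ℝ}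
    (hS : S.IsHermitian) {c c' : ℝ} (hc : 0 < c) (hspec : spectrum ℝ S ⊆ Set.Icc c c')
    (a : Fin n) : ∑ b, S⁻¹ a b ^ 2 ≤ (1 / c) ^ 2 := by
  set v : Fin n → ℝ := fun b => S⁻¹ a b with hv
  have h1 := (dotProduct_mulVec_mem_Icc_of_spectrum_subset hS hspec v).1
  have h2 : v ⬝ᵥ (S *ᵥ v) = v a := by
    rw [Matrix.dotProduct_mulVec]
    have h3 : v ᵥ* S = Pi.single a 1 := by
      ext b
      have h4 := congrFun (congrFun (inv_mul_of_spectrum_subset hc hspec) a) b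
      rw [Matrix.mul_apply] at h4
      simp only [Matrix.vecMul, dotProduct, hv, h4, Matrix.one_apply, Pi.single_apply, eq_comm]
    rw [h3, single_dotProduct, one_mul]
  rw [h2] at h1
  have h3 : v a ^ 2 ≤ ∑ b, v b ^ 2 :=
    Finset.single_le_sum (fun b _ => sq_nonneg (v b)) (Finset.mem_univ a)
  change ∑ b, v b ^ 2 ≤ _
  set Q := ∑ b, v b ^ 2
  have hQ : 0 ≤ Q := Finset.sum_nonneg fun _ _ => sq_nonneg _
  have h4 : (c * Q) ^ 2 ≤ Q := (pow_le_pow_left₀ (by positivity) h1 2).trans h3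
  rcases hQ.eq_or_lt with h | h
  · rw [← h]; positivity
  · have h5 : c ^ 2 * Q ≤ 1 := by
      have : Q * (c ^ 2 * Q) ≤ Q * 1 := by nlinarith
      exact le_of_mul_le_mul_left this h
    rw [div_pow, one_pow, le_div_iff₀ (by positivity)]
    linarith

/-! ### The one-step estimator -/

theorem oneStepVar_eq {N n : ℕ} (Θ : Matrix (Fin n) (Fin n) ℝ) (X : Fin N → Fin n → ℝ)
    (j : Fin n) : oneStepVar Θ X j = 1 / (N : ℝ) * ∑ i, (Matrix.of X *ᵥ Θ j) i ^ 2 := by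
  rw [← dotProduct_sampleCov_mulVec, Matrix.dotProduct_mulVec]
  rfl

theorem mul_sampleCov_apply {N n : ℕ} (Θ : Matrix (Fin n) (Fin n) ℝ) (X : Fin N → Fin n → ℝ)
    (a b : Fin n) :
    (Θ * sampleCov X) a b = 1 / (N : ℝ) * ∑ i, (Matrix.of X *ᵥ Θ a) i * X i b := by
  rw [sampleCov, Matrix.mul_smul, Matrix.smul_apply, smul_eq_mul, ← Matrix.mul_assoc]
  congr 1
  rw [Matrix.mul_apply]
  refine Finset.sum_congr rfl fun i _ => ?_
  congr 1
  rw [Matrix.mul_apply]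
  exact Finset.sum_congr rfl fun c _ => mul_comm _ _

theorem sampleCov_apply {N n : ℕ} (X : Fin N → Fin n → ℝ) (a b : Fin n) :
    sampleCov X a b = 1 / (N : ℝ) * ∑ i, X i a * X i b := by
  rw [sampleCov, Matrix.smul_apply, smul_eq_mul, Matrix.mul_apply]
  rfl

/-- The entry (ΘΣ_N)_jj, at least 1 − μ by feasibility, is the empirical inner product of XΘ_j with
column j of X; apply Cauchy–Schwarz. -/
theorem one_sub_sq_le_oneStepVar_mul {N n : ℕ} {Θ : Matrix (Fin n) (Fin n) ℝ}
    {X : Fin N → Fin n → ℝ} {mu : ℝ} (hΘ : Θ ∈ climeFeasible (sampleCov X) mu) (hmu : mu ≤ 1)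
    (j : Fin n) : (1 - mu) ^ 2 ≤ oneStepVar Θ X j * sampleCov X j j := by
  have h1 : 1 - mu ≤ (Θ * sampleCov X) j j := by
    have h := hΘ j j
    rw [Matrix.sub_apply, Matrix.one_apply_eq] at h
    linarith [neg_le_of_abs_le h]
  refine (pow_le_pow_left₀ (by linarith) h1 2).trans ?_
  rw [mul_sampleCov_apply, oneStepVar_eq, sampleCov_apply, mul_pow]
  have h2 := Finset.sum_mul_sq_le_sq_mul_sq Finset.univ (Matrix.of X *ᵥ Θ j) (fun i => X i j)
  calc (1 / (N : ℝ)) ^ 2 * (∑ i, (Matrix.of X *ᵥ Θ j) i * X i j) ^ 2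
      ≤ (1 / (N : ℝ)) ^ 2 * ((∑ i, (Matrix.of X *ᵥ Θ j) i ^ 2) * ∑ i, X i j ^ 2) :=
        mul_le_mul_of_nonneg_left h2 (sq_nonneg _)
    _ = _ := by simp only [← sq]; ring

/-- The exact split into noise and bias: the initial estimator enters only through the bias,
multiplied by the small matrix ΘΣ_N − I. -/
theorem oneStep_response_sub {N n : ℕ} (Θ : Matrix (Fin n) (Fin n) ℝ) (X : Fin N → Fin n → ℝ)
    (βs b : Fin n → ℝ) (ε : Fin N → ℝ) (j : Fin n) :
    oneStep Θ X (response X βs ε) b j - βs j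
      = 1 / (N : ℝ) * ∑ i, (Matrix.of X *ᵥ Θ j) i * ε i
        - ∑ a, (Θ * sampleCov X - 1) j a * (b - βs) a := by
  have e1 : response X βs ε - Matrix.of X *ᵥ b = ε - Matrix.of X *ᵥ (b - βs) := by
    rw [response, Matrix.mulVec_sub]; abel
  have e2 : ∀ w : Fin N → ℝ, (Θ *ᵥ ((Matrix.of X)ᵀ *ᵥ w)) j = ∑ i, (Matrix.of X *ᵥ Θ j) i * w i := by
    intro w
    change Θ j ⬝ᵥ ((Matrix.of X)ᵀ *ᵥ w) = (Matrix.of X *ᵥ Θ j) ⬝ᵥ w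
    rw [Matrix.dotProduct_mulVec, Matrix.vecMul_transpose]
  have e3 : ∑ a, (Θ * sampleCov X) j a * (b - βs) a
      = 1 / (N : ℝ) * ∑ i, (Matrix.of X *ᵥ Θ j) i * (Matrix.of X *ᵥ (b - βs)) i := by
    simp only [mul_sampleCov_apply]
    simp only [Matrix.mulVec, dotProduct, Finset.mul_sum, Finset.sum_mul, Matrix.of_apply]
    rw [Finset.sum_comm]
    refine Finset.sum_congr rfl fun i _ => ?_
    refine Finset.sum_congr rfl fun a _ => ?_
    refine Finset.sum_congr rfl fun d _ => ?_
    ring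
  have e4 : ∑ a, (1 : Matrix (Fin n) (Fin n) ℝ) j a * (b - βs) a = (b - βs) j := by
    simp [Matrix.one_apply]
  simp only [oneStep, Pi.add_apply, Pi.smul_apply, smul_eq_mul, e1, e2, Matrix.sub_apply, sub_mul,
    Finset.sum_sub_distrib, e3, e4]
  simp only [Pi.sub_apply, mul_sub, Finset.sum_sub_distrib]
  ring

theorem abs_sum_mul_le_mul_vecL1 {ι : Type*} [Fintype ι] {u v : ι → ℝ} {κ : ℝ}
    (hu : ∀ a, |u a| ≤ κ) : |∑ a, u a * v a| ≤ κ * vecL1 v := by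
  rw [vecL1, Finset.mul_sum]
  refine (Finset.abs_sum_le_sum_abs _ _).trans (Finset.sum_le_sum fun a _ => ?_)
  rw [abs_mul]
  exact mul_le_mul_of_nonneg_right (hu a) (abs_nonneg _)

/-! ### Independence and Gaussian laws -/

/-- The joint law of the two families is a product of two product measures; regrouping coordinates
turns it into a product of the laws of the pairs. -/
theorem iIndepFun_prodMk_of_indepFun {Ω ι : Type*} [Fintype ι] [MeasurableSpace Ω] {P : Measure Ω}
    [IsProbabilityMeasure P] {Y Z : ι → Ω → ℝ} (hYm : ∀ i, Measurable (Y i))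
    (hZm : ∀ i, Measurable (Z i)) (hY : iIndepFun Y P) (hZ : iIndepFun Z P)
    (hYZ : IndepFun (fun ω i => Y i ω) (fun ω i => Z i ω) P) :
    iIndepFun (fun i ω => (Y i ω, Z i ω)) P := by
  have hY' : Measurable (fun ω i => Y i ω) := measurable_pi_lambda _ hYm
  have hZ' : Measurable (fun ω i => Z i ω) := measurable_pi_lambda _ hZm
  have := fun i => Measure.isProbabilityMeasure_map (μ := P) (hYm i).aemeasurable
  have := fun i => Measure.isProbabilityMeasure_map (μ := P) (hZm i).aemeasurable
  rw [iIndepFun_iff_map_fun_eq_pi_map fun i => ((hYm i).prodMk (hZm i)).aemeasurable]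
  have h1 := (indepFun_iff_map_prod_eq_prod_map_map hY'.aemeasurable hZ'.aemeasurable).1 hYZ
  rw [hY.map_fun_eq_pi_map fun i => (hYm i).aemeasurable,
    hZ.map_fun_eq_pi_map fun i => (hZm i).aemeasurable] at h1
  have h2 := (measurePreserving_arrowProdEquivProdArrow ℝ ℝ ι (fun i => P.map (Y i))
    (fun i => P.map (Z i))).symm
  have h3 := h2.map_eq
  rw [← h1, Measure.map_map h2.measurable (hY'.prodMk hZ')] at h3
  have h4 : ∀ i, P.map (fun ω => (Y i ω, Z i ω)) = (P.map (Y i)).prod (P.map (Z i)) := fun i =>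
    (indepFun_iff_map_prod_eq_prod_map_map (hYm i).aemeasurable (hZm i).aemeasurable).1
      (hYZ.comp (measurable_pi_apply i) (measurable_pi_apply i))
  simp only [h4]
  exact h3

theorem hasSubgaussianMGF_of_map_eq_gaussianReal {Ω : Type*} [MeasurableSpace Ω] {P : Measure Ω}
    {Z : Ω → ℝ} (hZm : Measurable Z) {v : NNReal} (h : P.map Z = gaussianReal 0 v) :
    HasSubgaussianMGF Z v P where
  integrable_exp_mul t := by
    have := integrable_exp_mul_gaussianReal (μ := 0) (v := v) t
    rw [← h] at this
    exact (integrable_map_measure (by fun_prop) hZm.aemeasurable).1 this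
  mgf_le t := by
    rw [mgf_gaussianReal h]
    simp

theorem map_sum_mul_eq_gaussianReal {Ω : Type*} [MeasurableSpace Ω] {P : Measure Ω}
    [IsProbabilityMeasure P] {N : ℕ} {σ : ℝ} (hσ : 0 < σ) {ε : Ω → Fin N → ℝ}
    (hε : IsGaussianNoise σ ε P) {a : Fin N → ℝ} (ha : ∑ i, a i ^ 2 = 1) :
    P.map (fun ω => ∑ i, a i / σ * ε ω i) = gaussianReal 0 1 := by
  have hm : ∀ i, Measurable (fun ω => ε ω i) := fun i => (measurable_pi_apply i).comp hε.measurable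
  have hind : iIndepFun (fun i ω => a i / σ * ε ω i) P :=
    hε.indep.comp (fun i x => a i / σ * x) (fun i => by fun_prop)
  have hmeas : Measurable (fun ω => ∑ i, a i / σ * ε ω i) :=
    Finset.measurable_sum _ fun i _ => (hm i).const_mul _
  have := Measure.isProbabilityMeasure_map (μ := P) hmeas.aemeasurable
  refine Measure.ext_of_charFun ?_
  rw [iIndepFun.charFun_map_fun_sum_eq_prod (fun i => ((hm i).const_mul _).aemeasurable) hind]
  ext t
  rw [Finset.prod_apply, charFun_gaussianReal]
  have h1 : ∀ i, charFun (P.map (fun ω => a i / σ * ε ω i)) t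
      = Complex.exp (-((a i ^ 2 * t ^ 2 / 2 : ℝ) : ℂ)) := by
    intro i
    have h2 : P.map (fun ω => a i / σ * ε ω i) = (P.map (fun ω => ε ω i)).map (a i / σ * ·) := by
      rw [Measure.map_map (by fun_prop) (hm i)]; rfl
    rw [h2, hε.law i, gaussianReal_map_const_mul, charFun_gaussianReal]
    have h3 : (((NNReal.mk ((a i / σ) ^ 2) (sq_nonneg _) * (σ ^ 2).toNNReal : NNReal) : ℝ))
        = a i ^ 2 := by
      rw [NNReal.coe_mul, Real.coe_toNNReal _ (sq_nonneg σ), NNReal.coe_mk]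
      field_simp
    rw [h3]
    congr 1
    push_cast
    ring
  simp only [h1]
  rw [← Complex.exp_sum, Finset.sum_neg_distrib, ← Complex.ofReal_sum, ← Finset.sum_div,
    ← Finset.sum_mul, ha]
  congr 1
  push_cast
  ring

/-- A random unit combination of Gaussian noise variables, with weights that are independent of
the noise, is standard normal. -/
theorem map_random_sum_mul_eq_gaussianReal {Ω E : Type*} [MeasurableSpace Ω] [MeasurableSpace E]
    {P : Measure Ω} [IsProbabilityMeasure P] {N : ℕ} {σ : ℝ} (hσ : 0 < σ) {ε : Ω → Fin N → ℝ}
    (hε : IsGaussianNoise σ ε P) {X : Ω → E} (hX : Measurable X) (hXε : IndepFun X ε P)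
    {u : E → Fin N → ℝ} (hu : Measurable u) (hu1 : ∀ x, ∑ i, u x i ^ 2 = 1) :
    P.map (fun ω => ∑ i, u (X ω) i / σ * ε ω i) = gaussianReal 0 1 := by
  have hf : Measurable (fun p : E × (Fin N → ℝ) => ∑ i, u p.1 i / σ * p.2 i) := by
    refine Finset.measurable_sum _ fun i _ => ?_
    have h1 : Measurable (fun p : E × (Fin N → ℝ) => u p.1 i) :=
      (measurable_pi_apply i).comp (hu.comp measurable_fst)
    have h2 : Measurable (fun p : E × (Fin N → ℝ) => p.2 i) :=
      (measurable_pi_apply i).comp measurable_snd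
    exact (h1.div_const σ).mul h2
  have h1 := (indepFun_iff_map_prod_eq_prod_map_map hX.aemeasurable
    hε.measurable.aemeasurable).1 hXε
  have := Measure.isProbabilityMeasure_map (μ := P) hX.aemeasurable
  have := Measure.isProbabilityMeasure_map (μ := P) hε.measurable.aemeasurable
  have h2 : P.map (fun ω => ∑ i, u (X ω) i / σ * ε ω i)
      = ((P.map X).prod (P.map ε)).map (fun p => ∑ i, u p.1 i / σ * p.2 i) := by
    rw [← h1, Measure.map_map hf (hX.prodMk hε.measurable)]; rfl
  rw [h2]
  ext A hA
  rw [Measure.map_apply hf hA, Measure.prod_apply (hf hA)]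
  -- Conditionally on X = x the weights are a fixed unit vector, so every section has the same
  -- Gaussian mass and integrating over x changes nothing.
  have h3 : ∀ x, (P.map ε) (Prod.mk x ⁻¹' ((fun p : E × (Fin N → ℝ) =>
      ∑ i, u p.1 i / σ * p.2 i) ⁻¹' A)) = gaussianReal 0 1 A := by
    intro x
    have h4 : Measurable (fun ω => ∑ i, u x i / σ * ε ω i) := Finset.measurable_sum _ fun i _ =>
      ((measurable_pi_apply i).comp hε.measurable).const_mul _
    rw [← map_sum_mul_eq_gaussianReal hσ hε (hu1 x), Measure.map_apply h4 hA,
      Measure.map_apply hε.measurable (measurable_prodMk_left (hf hA))]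
    rfl
  simp only [h3, lintegral_const, measure_univ, mul_one]

/-! ### Convergence in distribution -/

/-- A sequence of random variables, possibly on different probability spaces, that is close in
probability to random variables with a fixed law converges in distribution to this law. -/
theorem tendstoInDistribution_of_eventually_close {Ω : ℕ → Type*} [∀ l, MeasurableSpace (Ω l)]
    {P : (l : ℕ) → Measure (Ω l)} [∀ l, IsProbabilityMeasure (P l)] {γ : Measure ℝ}
    [IsProbabilityMeasure γ] {T : (l : ℕ) → Ω l → ℝ} (hT : ∀ l, Measurable (T l))
    {r p : ℕ → ℝ} (hr : Tendsto r atTop (𝓝 0)) (hp : Tendsto p atTop (𝓝 0))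
    (hclose : ∀ᶠ l in atTop, 0 ≤ r l ∧ ∃ W : Ω l → ℝ, Measurable W ∧ (P l).map W = γ ∧
      (P l).real {ω | r l < |T l ω - W ω|} ≤ p l) :
    TendstoInDistribution T atTop (id : ℝ → ℝ) P γ := by
  refine ⟨fun l => (hT l).aemeasurable, aemeasurable_id, ?_⟩
  -- For a bounded Lipschitz test function the integrals differ by at most L r off the bad event,
  -- plus the oscillation C times the probability of that event.
  refine tendsto_iff_forall_lipschitz_integral_tendsto.2 ?_
  rintro f ⟨C, hC⟩ ⟨L, hL⟩
  simp only [ProbabilityMeasure.coe_mk, Measure.map_id]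
  have hfc : Continuous f := hL.continuous
  have hC0 : 0 ≤ C := dist_nonneg.trans (hC 0 0)
  have hlim : Tendsto (fun l => L * r l + C * p l) atTop (𝓝 0) := by
    simpa using (hr.const_mul (L : ℝ)).add (hp.const_mul C)
  rw [tendsto_iff_dist_tendsto_zero]
  refine squeeze_zero' (Eventually.of_forall fun _ => dist_nonneg) ?_ hlim
  filter_upwards [hclose] with l hl
  obtain ⟨hrl, W, hW, hWγ, hbad⟩ := hl
  have hint : ∀ {V : Ω l → ℝ}, Measurable V → Integrable (fun ω => f (V ω)) (P l) := by
    intro V hV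
    refine Integrable.of_bound (hfc.measurable.comp hV).aestronglyMeasurable (|f 0| + C)
      (Eventually.of_forall fun ω => ?_)
    have h1 := hC (V ω) 0
    rw [Real.dist_eq] at h1
    rw [Real.norm_eq_abs]
    have h2 := abs_sub_abs_le_abs_sub (f (V ω)) (f 0)
    linarith
  rw [integral_map (hT l).aemeasurable hfc.aestronglyMeasurable, ← hWγ,
    integral_map hW.aemeasurable hfc.aestronglyMeasurable, Real.dist_eq,
    ← integral_sub (hint (hT l)) (hint hW)]
  set B : Set (Ω l) := {ω | r l < |T l ω - W ω|} with hB
  have hBm : MeasurableSet B :=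
    measurableSet_lt measurable_const ((hT l).sub hW).abs
  have hpt : ∀ ω, |f (T l ω) - f (W ω)| ≤ L * r l + B.indicator (fun _ => C) ω := by
    intro ω
    by_cases h : ω ∈ B
    · rw [Set.indicator_of_mem h]
      have h1 := hC (T l ω) (W ω)
      rw [Real.dist_eq] at h1
      have h2 : 0 ≤ L * r l := mul_nonneg L.2 hrl
      linarith
    · rw [Set.indicator_of_notMem h, add_zero]
      have h1 := hL.dist_le_mul (T l ω) (W ω)
      rw [Real.dist_eq, Real.dist_eq] at h1
      exact h1.trans (mul_le_mul_of_nonneg_left (not_lt.1 h) L.2)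
  have hindi : Integrable (B.indicator (fun _ => C)) (P l) := (integrable_const C).indicator hBm
  calc |∫ ω, (f (T l ω) - f (W ω)) ∂(P l)| ≤ ∫ ω, |f (T l ω) - f (W ω)| ∂(P l) :=
        abs_integral_le_integral_abs
    _ ≤ ∫ ω, (L * r l + B.indicator (fun _ => C) ω) ∂(P l) :=
        integral_mono ((hint (hT l)).sub (hint hW)).abs ((integrable_const _).add hindi) hpt
    _ = L * r l + C * (P l).real B := by
        rw [integral_add (integrable_const _) hindi, integral_indicator_const _ hBm]
        simp [mul_comm]
    _ ≤ L * r l + C * p l := by gcongr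

/-! ### Quantiles of the standard normal distribution -/

theorem continuous_cdf_of_nullSingletonClass (γ : Measure ℝ) [IsProbabilityMeasure γ]
    [NullSingletonClass γ] : Continuous (cdf γ) := by
  rw [continuous_iff_continuousAt]
  intro x
  rw [(monotone_cdf γ).continuousAt_iff_leftLim_eq_rightLim, (cdf γ).rightLim_eq]
  have h := (cdf γ).measure_singleton x
  rw [measure_cdf, measure_singleton, eq_comm, ENNReal.ofReal_eq_zero] at h
  exact le_antisymm ((monotone_cdf γ).leftLim_le le_rfl) (by linarith)

/-- Continuity makes the set {q ≤ F} closed, so its infimum belongs to it; to the left F is at most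
q, and this passes to the limit. -/
theorem cdf_stdNormalQuantile {q : ℝ} (hq0 : 0 < q) (hq1 : q < 1) :
    cdf (gaussianReal 0 1) (stdNormalQuantile q) = q := by
  have := nullSingletonClass_gaussianReal (μ := 0) (v := 1) one_ne_zero
  have hc := continuous_cdf_of_nullSingletonClass (gaussianReal 0 1)
  set F := cdf (gaussianReal 0 1) with hF
  set A : Set ℝ := {x | q ≤ F x} with hA
  have hne : A.Nonempty := by
    obtain ⟨x, hx⟩ := ((tendsto_cdf_atTop (gaussianReal 0 1)).eventually_const_le hq1).exists
    exact ⟨x, hx⟩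
  have hbdd : BddBelow A := by
    obtain ⟨x, hx⟩ := ((tendsto_cdf_atBot (gaussianReal 0 1)).eventually_lt_const hq0).exists
    refine ⟨x, fun y hy => le_of_not_gt fun hyx => ?_⟩
    exact absurd (hy.trans (monotone_cdf _ hyx.le)) (not_le.2 hx)
  have hcl : IsClosed A := isClosed_le continuous_const hc
  have hmem : q ≤ F (sInf A) := hcl.csInf_mem hne hbdd
  refine le_antisymm ?_ hmem
  have hlt : ∀ x ∈ Set.Iio (sInf A), F x ≤ q := fun x hx =>
    le_of_not_ge fun h => absurd (csInf_le hbdd h) (not_le.2 hx)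
  exact le_of_tendsto (hc.continuousWithinAt (x := sInf A) (s := Set.Iio (sInf A))).tendsto
    (eventually_mem_nhdsWithin.mono hlt)

theorem gaussianReal_real_Iio_neg (x : ℝ) :
    (gaussianReal 0 1).real (Set.Iio (-x)) = (gaussianReal 0 1).real (Set.Ioi x) := by
  have h := gaussianReal_map_neg (μ := 0) (v := 1)
  rw [neg_zero] at h
  conv_lhs => rw [← h]
  rw [map_measureReal_apply measurable_neg measurableSet_Iio]
  congr 1
  ext y
  simp

theorem gaussianReal_real_lt_abs {α : ℝ} (hα0 : 0 < α) (hα1 : α < 1) :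
    (gaussianReal 0 1).real {x | stdNormalQuantile (1 - α / 2) < |x|} = α := by
  set z := stdNormalQuantile (1 - α / 2) with hz
  have hcdf := cdf_stdNormalQuantile (q := 1 - α / 2) (by linarith) (by linarith)
  rw [← hz, cdf_eq_real] at hcdf
  have hIoi : ∀ x, (gaussianReal 0 1).real (Set.Ioi x)
      = 1 - (gaussianReal 0 1).real (Set.Iic x) := by
    intro x
    rw [← Set.compl_Iic, probReal_compl_eq_one_sub measurableSet_Iic]
  -- Needed for the two tails to be disjoint. A negative z would put (−∞, z], of mass 1 − α/2,
  -- inside (−∞, −z), of mass α/2.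
  have hz0 : 0 ≤ z := by
    by_contra! hneg
    have h1 : (gaussianReal 0 1).real (Set.Iic z) ≤ (gaussianReal 0 1).real (Set.Iio (-z)) :=
      measureReal_mono fun x (hx : x ≤ z) => show x < -z by linarith
    rw [gaussianReal_real_Iio_neg, hIoi] at h1
    linarith
  have hset : {x : ℝ | z < |x|} = Set.Ioi z ∪ Set.Iio (-z) := by
    ext x
    simp only [Set.mem_ofPred_eq, Set.mem_union, Set.mem_Ioi, Set.mem_Iio, lt_abs]
    constructor <;> rintro (h | h) <;> first | (left; linarith) | (right; linarith)
  have hdisj : Disjoint (Set.Ioi z) (Set.Iio (-z)) := by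
    rw [Set.disjoint_left]
    intro x (hx : z < x) (hx' : x < -z)
    linarith
  rw [hset, measureReal_union hdisj measurableSet_Iio, gaussianReal_real_Iio_neg, hIoi, hcdf]
  ring

theorem tendsto_real_stdNormalQuantile_lt_abs {Ω : ℕ → Type*}
    [∀ l, MeasurableSpace (Ω l)] {P : (l : ℕ) → Measure (Ω l)} [∀ l, IsProbabilityMeasure (P l)]
    {T : (l : ℕ) → Ω l → ℝ} (hT : ∀ l, Measurable (T l))
    (h : TendstoInDistribution T atTop (id : ℝ → ℝ) P (gaussianReal 0 1))
    {α : ℝ} (hα0 : 0 < α) (hα1 : α < 1) :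
    Tendsto (fun l => (P l).real {ω | stdNormalQuantile (1 - α / 2) < |T l ω|}) atTop (𝓝 α) := by
  set z := stdNormalQuantile (1 - α / 2) with hz
  have hopen : MeasurableSet {x : ℝ | z < |x|} :=
    (isOpen_lt continuous_const continuous_abs).measurableSet
  -- The boundary lies in {z, −z}, which has no Gaussian mass, so the portmanteau theorem applies to
  -- this event.
  have hfr : gaussianReal 0 1 (frontier {x : ℝ | z < |x|}) = 0 := by
    have := nullSingletonClass_gaussianReal (μ := 0) (v := 1) one_ne_zero
    have hsub : frontier {x : ℝ | z < |x|} ⊆ {z, -z} := by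
      refine (frontier_lt_subset_eq continuous_const continuous_abs).trans ?_
      intro x (hx : z = |x|)
      rcases abs_choice x with h1 | h1
      · left; rw [hx, h1]
      · right; rw [hx, h1, neg_neg]; rfl
    exact measure_mono_null hsub ((Set.toFinite _).measure_zero _)
  have h1 := ProbabilityMeasure.tendsto_measure_of_null_frontier_of_tendsto' h.tendsto
    (E := {x : ℝ | z < |x|}) (by
      simp only [ProbabilityMeasure.coe_mk, Measure.map_id]
      exact hfr)
  simp only [ProbabilityMeasure.coe_mk, Measure.map_id] at h1
  have h2 := (ENNReal.tendsto_toReal (measure_ne_top _ _)).comp h1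
  have h3 : (gaussianReal 0 1 {x : ℝ | z < |x|}).toReal = α := gaussianReal_real_lt_abs hα0 hα1
  rw [h3] at h2
  refine h2.congr fun l => ?_
  rw [Function.comp_apply, Measure.map_apply (hT l) hopen]
  rfl

/-! ### Concentration of the design -/

/-- Rescale v to a unit vector and move its length into t; the zero vector is treated apart. -/
theorem IsSubGaussianVec.hasSubgaussianMGF_dotProduct {Ω : Type*} [MeasurableSpace Ω]
    {P : Measure Ω} [IsProbabilityMeasure P] {n : ℕ} {σ : ℝ} {V : Ω → Fin n → ℝ}
    (hV : IsSubGaussianVec σ V P) {v : Fin n → ℝ} {r : ℝ} (hv : ∑ a, v a ^ 2 ≤ r ^ 2) :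
    HasSubgaussianMGF (fun ω => v ⬝ᵥ V ω) ((σ * r) ^ 2).toNNReal P := by
  set Q := ∑ a, v a ^ 2 with hQ
  have hQ0 : 0 ≤ Q := Finset.sum_nonneg fun _ _ => sq_nonneg _
  rcases hQ0.eq_or_lt with h | h
  · have h0 : ∀ a, v a = 0 := by
      intro a
      have := (Finset.sum_eq_zero_iff_of_nonneg fun a _ => sq_nonneg (v a)).1 h.symm a
        (Finset.mem_univ a)
      exact pow_eq_zero_iff two_ne_zero |>.1 this
    have h1 : (fun ω => v ⬝ᵥ V ω) = fun _ => (0 : ℝ) := by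
      ext ω; simp [dotProduct, h0]
    rw [h1]
    exact ⟨fun t => by simp, fun t => by
      simp only [mgf, mul_zero, Real.exp_zero, integral_const, probReal_univ, smul_eq_mul, mul_one]
      exact Real.one_le_exp (by positivity)⟩
  · have ht : 0 < √Q := Real.sqrt_pos.2 h
    have ht2 : √Q ^ 2 = Q := Real.sq_sqrt hQ0
    have hu : ∑ a, (v a / √Q) ^ 2 = 1 := by
      simp only [div_pow, ht2]
      rw [← Finset.sum_div, div_self h.ne']
    have hs := (hV.2 (fun a => v a / √Q) hu).2
    have he : ∀ (t : ℝ) ω, t * (v ⬝ᵥ V ω) = t * √Q * ((fun a => v a / √Q) ⬝ᵥ V ω) := by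
      intro t ω
      simp only [dotProduct, Finset.mul_sum]
      refine Finset.sum_congr rfl fun a _ => ?_
      field_simp
    constructor
    · intro t
      simp only [he]
      exact hs.integrable_exp_mul _
    · intro t
      have h1 := hs.mgf_le (t * √Q)
      simp only [mgf, he]
      refine h1.trans (Real.exp_le_exp.2 ?_)
      rw [Real.coe_toNNReal _ (sq_nonneg _), Real.coe_toNNReal _ (sq_nonneg _), mul_pow t, ht2,
        mul_pow σ]
      have : σ ^ 2 * (t ^ 2 * Q) ≤ σ ^ 2 * (t ^ 2 * r ^ 2) := by gcongr
      linarith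

theorem sum_sq_single {n : ℕ} (a : Fin n) :
    ∑ b, (Pi.single a (1 : ℝ) : Fin n → ℝ) b ^ 2 = 1 := by
  simp [Pi.single_apply]

theorem IsSubGaussianVec.hasSubgaussianMGF_apply {Ω : Type*} [MeasurableSpace Ω]
    {P : Measure Ω} [IsProbabilityMeasure P] {n : ℕ} {σ : ℝ} {V : Ω → Fin n → ℝ}
    (hV : IsSubGaussianVec σ V P) (a : Fin n) :
    HasSubgaussianMGF (fun ω => V ω a) (σ ^ 2).toNNReal P := by
  have h := (hV.2 (Pi.single a 1) (sum_sq_single a)).2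
  simpa using h

namespace IsRowwiseSubGaussian

variable {Ω : Type*} [MeasurableSpace Ω] {P : Measure Ω} {N n : ℕ}
  {σ : ℝ} {S : Matrix (Fin n) (Fin n) ℝ} {X : Ω → Fin N → Fin n → ℝ}

theorem measurable_apply (hX : IsRowwiseSubGaussian σ S X P) (i : Fin N) (a : Fin n) :
    Measurable fun ω => X ω i a :=
  (measurable_pi_apply a).comp ((measurable_pi_apply i).comp hX.measurable)

theorem isHermitian (hX : IsRowwiseSubGaussian σ S X P) (hN : 0 < N) : S.IsHermitian := by
  ext a b
  rw [Matrix.conjTranspose_apply, star_trivial, ← hX.covariance_eq ⟨0, hN⟩ b a,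
    ← hX.covariance_eq ⟨0, hN⟩ a b, covariance_comm]

theorem integrable_mul [IsProbabilityMeasure P] (hX : IsRowwiseSubGaussian σ S X P) (i : Fin N) (a b : Fin n) :
    Integrable (fun ω => X ω i a * X ω i b) P := by
  have hL : ∀ a, MemLp (fun ω => X ω i a) 2 P := fun a =>
    ((hX.subGaussian i).hasSubgaussianMGF_apply a).memLp 2
  exact (hL a).integrable_mul (hL b)

theorem integral_mul (hX : IsRowwiseSubGaussian σ S X P) (i : Fin N) (a b : Fin n) :
    ∫ ω, X ω i a * X ω i b ∂P = S a b := by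
  rw [← hX.covariance_eq i a b, covariance]
  simp only [((hX.subGaussian i).1 a).2, ((hX.subGaussian i).1 b).2, sub_zero]

theorem integral_dotProduct_mul [IsProbabilityMeasure P]
    (hX : IsRowwiseSubGaussian σ S X P) (i : Fin N) (v : Fin n → ℝ)
    (b : Fin n) : ∫ ω, (v ⬝ᵥ X ω i) * X ω i b ∂P = (v ᵥ* S) b := by
  simp only [dotProduct, Finset.sum_mul, Matrix.vecMul, mul_assoc]
  rw [integral_finsetSum _ fun a _ => (hX.integrable_mul i a b).const_mul _]
  refine Finset.sum_congr rfl fun a _ => ?_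
  rw [integral_const_mul, hX.integral_mul]

end IsRowwiseSubGaussian

/-- One estimate for two uses: v = e_a controls Σ_N − Σ_x, and v a row of Σ_x⁻¹ controls Σ_x⁻¹Σ_N −
I. -/
theorem measureReal_design_deviation_le.{u} {A B : ℝ} (hAB : IsProductBernsteinConst.{u} A B)
    {Ω : Type u} [MeasurableSpace Ω] {P : Measure Ω} [IsProbabilityMeasure P] {N n : ℕ}
    (hN : 0 < N) (hn : 2 ≤ n) (hB : Real.log n / N ≤ B) {σ : ℝ} (hσ : 0 < σ)
    {S : Matrix (Fin n) (Fin n) ℝ} {X : Ω → Fin N → Fin n → ℝ}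
    (hX : IsRowwiseSubGaussian σ S X P) {v : Fin n → ℝ} {r : ℝ} (hr : 0 < r)
    (hv : ∑ a, v a ^ 2 ≤ r ^ 2) (b : Fin n) :
    P.real {ω | σ * r * σ * A * √(Real.log n / N)
      < |1 / (N : ℝ) * ∑ i, (v ⬝ᵥ X ω i) * X ω i b - (v ᵥ* S) b|} ≤ 2 / (n : ℝ) ^ 3 := by
  have hdm : Measurable (fun x : Fin n → ℝ => v ⬝ᵥ x) :=
    Finset.measurable_sum _ fun a _ => (measurable_pi_apply a).const_mul _
  refine hAB P N n (fun i ω => v ⬝ᵥ X ω i) (fun i ω => X ω i b) (σ * r) σ ((v ᵥ* S) b) hN hn hB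
    (by positivity) hσ (fun i => hdm.comp ((measurable_pi_apply i).comp hX.measurable))
    (fun i => hX.measurable_apply i b)
    (fun i => (hX.subGaussian i).hasSubgaussianMGF_dotProduct hv)
    (fun i => (hX.subGaussian i).hasSubgaussianMGF_apply b) ?_
    (fun i => hX.integral_dotProduct_mul i v b)
  exact hX.indep.comp (fun _ x => (v ⬝ᵥ x) * x b) fun _ => hdm.mul (measurable_pi_apply b)

theorem measureReal_noise_deviation_le.{u} {A B : ℝ} (hAB : IsProductBernsteinConst.{u} A B)
    {Ω : Type u} [MeasurableSpace Ω] {P : Measure Ω} [IsProbabilityMeasure P] {N n : ℕ}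
    (hN : 0 < N) (hn : 2 ≤ n) (hB : Real.log n / N ≤ B) {σ τ : ℝ} (hσ : 0 < σ) (hτ : 0 < τ)
    {S : Matrix (Fin n) (Fin n) ℝ} {X : Ω → Fin N → Fin n → ℝ} {ε : Ω → Fin N → ℝ}
    (hX : IsRowwiseSubGaussian σ S X P) (hε : IsGaussianNoise τ ε P) (hXε : IndepFun X ε P)
    (a : Fin n) :
    P.real {ω | σ * τ * A * √(Real.log n / N) < |1 / (N : ℝ) * ∑ i, X ω i a * ε ω i|}
      ≤ 2 / (n : ℝ) ^ 3 := by
  have hεm : ∀ i, Measurable fun ω => ε ω i := fun i =>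
    (measurable_pi_apply i).comp hε.measurable
  have hεs : ∀ i, HasSubgaussianMGF (fun ω => ε ω i) (τ ^ 2).toNNReal P := fun i =>
    hasSubgaussianMGF_of_map_eq_gaussianReal (hεm i) (hε.law i)
  have hrow : Measurable (fun (x : Fin N → Fin n → ℝ) (i : Fin N) => x i a) :=
    measurable_pi_lambda _ fun i => (measurable_pi_apply a).comp (measurable_pi_apply i)
  have hind : iIndepFun (fun i ω => X ω i a * ε ω i) P := by
    have h := iIndepFun_prodMk_of_indepFun (fun i => hX.measurable_apply i a) hεm
      (hX.indep.comp (fun _ x => x a) fun _ => measurable_pi_apply a) hε.indep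
      (hXε.comp hrow measurable_id)
    exact h.comp (fun _ p => p.1 * p.2) fun _ => measurable_fst.mul measurable_snd
  have hmean : ∀ i, ∫ ω, X ω i a * ε ω i ∂P = 0 := by
    intro i
    have hi : IndepFun (fun ω => X ω i a) (fun ω => ε ω i) P :=
      hXε.comp ((measurable_pi_apply i).comp hrow) (measurable_pi_apply i)
    rw [hi.integral_fun_mul_eq_mul_integral (hX.measurable_apply i a).aestronglyMeasurable
      (hεm i).aestronglyMeasurable, ((hX.subGaussian i).1 a).2, zero_mul]
  have h := hAB P N n (fun i ω => X ω i a) (fun i ω => ε ω i) σ τ 0 hN hn hB hσ hτ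
    (fun i => hX.measurable_apply i a) hεm
    (fun i => (hX.subGaussian i).hasSubgaussianMGF_apply a) hεs hind hmean
  simpa only [sub_zero] using h

theorem measureReal_exists_le {Ω ι : Type*} [Fintype ι] [MeasurableSpace Ω] {P : Measure Ω}
    [IsProbabilityMeasure P] {E : ι → Set Ω} {p : ℝ} (h : ∀ i, P.real (E i) ≤ p) :
    P.real {ω | ∃ i, ω ∈ E i} ≤ Fintype.card ι * p := by
  have h1 : {ω | ∃ i, ω ∈ E i} = ⋃ i, E i := by ext; simp
  rw [h1]
  refine (measureReal_iUnion_fintype_le E).trans ((Finset.sum_le_sum fun i _ => h i).trans ?_)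
  simp

/-- The event on which the sample covariance matrix, its product with the population precision
matrix and the noise scores are all close to their expectations. -/
def designEvent {Ω : Type*} {N n : ℕ} (A σ τ c : ℝ) (S : Matrix (Fin n) (Fin n) ℝ)
    (X : Ω → Fin N → Fin n → ℝ) (ε : Ω → Fin N → ℝ) : Set Ω :=
  {ω | (∀ a b, |(sampleCov (X ω) - S) a b| ≤ σ * σ * A * √(Real.log n / N)) ∧
    (∀ a b, |(S⁻¹ * sampleCov (X ω) - 1) a b| ≤ σ * (1 / c) * σ * A * √(Real.log n / N)) ∧
    ∀ a, |1 / (N : ℝ) * ∑ i, X ω i a * ε ω i| ≤ σ * τ * A * √(Real.log n / N)}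

theorem measureReal_compl_designEvent_le.{u} {A B : ℝ} (hAB : IsProductBernsteinConst.{u} A B)
    {Ω : Type u} [MeasurableSpace Ω] {P : Measure Ω} [IsProbabilityMeasure P] {N n : ℕ}
    (hN : 0 < N) (hn : 2 ≤ n) (hB : Real.log n / N ≤ B) {σ τ : ℝ} (hσ : 0 < σ) (hτ : 0 < τ)
    {S : Matrix (Fin n) (Fin n) ℝ} {X : Ω → Fin N → Fin n → ℝ} {ε : Ω → Fin N → ℝ}
    (hX : IsRowwiseSubGaussian σ S X P) (hε : IsGaussianNoise τ ε P) (hXε : IndepFun X ε P)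
    {c c' : ℝ} (hc : 0 < c) (hS : spectrum ℝ S ⊆ Set.Icc c c') :
    P.real (designEvent A σ τ c S X ε)ᶜ ≤ 6 / n := by
  set ρ := √(Real.log n / N) with hρ
  have h1 : ∀ p : Fin n × Fin n,
      P.real {ω | σ * σ * A * ρ < |(sampleCov (X ω) - S) p.1 p.2|} ≤ 2 / (n : ℝ) ^ 3 := by
    intro p
    have h := measureReal_design_deviation_le hAB hN hn hB hσ hX (v := Pi.single p.1 1) one_pos
      (by rw [sum_sq_single]; norm_num) p.2
    simpa only [single_dotProduct, one_mul, mul_one, Matrix.single_one_vecMul, Matrix.row_apply,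
      Matrix.sub_apply, sampleCov_apply] using h
  have h2 : ∀ p : Fin n × Fin n,
      P.real {ω | σ * (1 / c) * σ * A * ρ < |(S⁻¹ * sampleCov (X ω) - 1) p.1 p.2|}
        ≤ 2 / (n : ℝ) ^ 3 := by
    intro p
    have h := measureReal_design_deviation_le hAB hN hn hB hσ hX (v := S⁻¹ p.1)
      (r := 1 / c) (by positivity) (sum_sq_inv_row_le (hX.isHermitian hN) hc hS p.1) p.2
    have e1 : (S⁻¹ p.1 ᵥ* S) p.2 = (1 : Matrix (Fin n) (Fin n) ℝ) p.1 p.2 := by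
      rw [← inv_mul_of_spectrum_subset hc hS]; rfl
    have e2 : ∀ ω i, (Matrix.of (X ω) *ᵥ S⁻¹ p.1) i = S⁻¹ p.1 ⬝ᵥ X ω i := fun ω i =>
      dotProduct_comm _ _
    simpa only [Matrix.sub_apply, mul_sampleCov_apply, e1, e2] using h
  have h3 := fun a => measureReal_noise_deviation_le hAB hN hn hB hσ hτ hX hε hXε a
  have u1 := measureReal_exists_le h1
  have u2 := measureReal_exists_le h2
  have u3 := measureReal_exists_le h3
  have hsub : (designEvent A σ τ c S X ε)ᶜ
      ⊆ {ω | ∃ p : Fin n × Fin n, ω ∈ {ω | σ * σ * A * ρ < |(sampleCov (X ω) - S) p.1 p.2|}}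
        ∪ ({ω | ∃ p : Fin n × Fin n,
            ω ∈ {ω | σ * (1 / c) * σ * A * ρ < |(S⁻¹ * sampleCov (X ω) - 1) p.1 p.2|}}
          ∪ {ω | ∃ a, ω ∈ {ω | σ * τ * A * ρ < |1 / (N : ℝ) * ∑ i, X ω i a * ε ω i|}}) := by
    intro ω hω
    by_contra hcon
    simp only [Set.mem_union, Set.mem_ofPred_eq, not_or, not_exists, not_lt, Prod.forall] at hcon
    exact hω hcon
  refine (measureReal_mono hsub).trans ((measureReal_union_le _ _).trans
    ((add_le_add u1 ((measureReal_union_le _ _).trans (add_le_add u2 u3))).trans ?_))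
  rw [Fintype.card_prod, Fintype.card_fin]
  have hn1 : (1 : ℝ) ≤ n := by exact_mod_cast (by omega : 1 ≤ n)
  have hn0 : (0 : ℝ) < n := by linarith
  -- Two families of n² events and one of n events, each of probability at most 2/n³.
  have e3 : ((n * n : ℕ) : ℝ) * (2 / (n : ℝ) ^ 3) = 2 / n := by
    push_cast; field_simp
  have e4 : (n : ℝ) * (2 / (n : ℝ) ^ 3) ≤ 2 / n := by
    have : (n : ℝ) * (2 / (n : ℝ) ^ 3) = 2 / n / n := by field_simp
    rw [this]
    exact div_le_self (by positivity) hn1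
  rw [e3]
  have e5 : (6 : ℝ) / n = 2 / n + (2 / n + 2 / n) := by ring
  rw [e5]
  gcongr

/-! ### The one-step estimator is close to a standard normal variable -/

theorem measurable_mulVec_row {N n : ℕ}
    {Θhat : (Fin N → Fin n → ℝ) → Fin n → Fin n → ℝ} (hΘ : Measurable Θhat) (j : Fin n)
    (i : Fin N) : Measurable fun x : Fin N → Fin n → ℝ => (Matrix.of x *ᵥ Θhat x j) i := by
  simp only [Matrix.mulVec, dotProduct, Matrix.of_apply]
  refine Finset.measurable_sum _ fun a _ => ?_
  exact ((measurable_pi_apply a).comp (measurable_pi_apply i)).mul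
    ((measurable_pi_apply a).comp ((measurable_pi_apply j).comp hΘ))

/-- Where the variance factor vanishes the weights default to a basis vector. They are then unit for
every design, so the weighted noise is exactly standard normal without conditioning on a good event.
-/
theorem exists_measurable_unit_weights {N n : ℕ} (hN : 0 < N)
    {Θhat : (Fin N → Fin n → ℝ) → Fin n → Fin n → ℝ} (hΘ : Measurable Θhat) (j : Fin n) :
    ∃ u : (Fin N → Fin n → ℝ) → Fin N → ℝ, Measurable u ∧ (∀ x, ∑ i, u x i ^ 2 = 1) ∧
      ∀ x, 0 < oneStepVar (Matrix.of (Θhat x)) x j →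
        ∀ i, u x i = (Matrix.of x *ᵥ Θhat x j) i
          / (√(N : ℝ) * √(oneStepVar (Matrix.of (Θhat x)) x j)) := by
  have hN' : (0 : ℝ) < N := by exact_mod_cast hN
  set a : (Fin N → Fin n → ℝ) → Fin N → ℝ := fun x => Matrix.of x *ᵥ Θhat x j with ha
  set q : (Fin N → Fin n → ℝ) → ℝ := fun x => ∑ i, a x i ^ 2 with hq
  have hqv : ∀ x, oneStepVar (Matrix.of (Θhat x)) x j = 1 / (N : ℝ) * q x := fun x =>
    oneStepVar_eq _ x j
  have hqv' : ∀ x, √(N : ℝ) * √(oneStepVar (Matrix.of (Θhat x)) x j) = √(q x) := by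
    intro x
    rw [← Real.sqrt_mul hN'.le, hqv]
    congr 1
    field_simp
  have ham : ∀ i, Measurable fun x => a x i := fun i => measurable_mulVec_row hΘ j i
  have hqm : Measurable q := Finset.measurable_sum _ fun i _ => (ham i).pow_const 2
  classical
  refine ⟨fun x => if 0 < q x then fun i => a x i / √(q x) else Pi.single ⟨0, hN⟩ 1, ?_, ?_, ?_⟩
  · refine Measurable.ite (measurableSet_lt measurable_const hqm) ?_ measurable_const
    exact measurable_pi_lambda _ fun i => (ham i).div hqm.sqrt
  · intro x
    by_cases h : 0 < q x
    · simp only [h, if_true, div_pow, Real.sq_sqrt h.le]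
      rw [← Finset.sum_div]
      exact div_self h.ne'
    · simp only [h, if_false]
      exact sum_sq_single _
  · intro x hx i
    have h : 0 < q x := by
      rw [hqv] at hx
      exact pos_of_mul_pos_right hx (by positivity)
    simp only [h, if_true, hqv']
    rfl

/-- W is the noise weighted by the normalized vector XΘ_j. On the design event the studentized error
differs from W only by the bias, which the ℓ₁ bound controls; everything after the passage to that
event is deterministic. -/
theorem exists_close_standard_normal.{u} {A B : ℝ} (hA : 0 < A)
    (hAB : IsProductBernsteinConst.{u} A B)
    {Ω : Type u} [MeasurableSpace Ω] {P : Measure Ω} [IsProbabilityMeasure P] {N n k s₁ s₂ : ℕ}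
    {σ τ c c' ν lam lamg mu C₁ : ℝ} (hc : 0 < c) (hc' : 0 < c') (hσ : 0 < σ) (hτ : 0 < τ)
    {G : SimpleGraph (Fin n)} {βs : Fin n → ℝ} {S : Matrix (Fin n) (Fin n) ℝ}
    {X : Ω → Fin N → Fin n → ℝ} {ε : Ω → Fin N → ℝ} {βhat : Ω → Fin n → ℝ}
    {Θhat : (Fin N → Fin n → ℝ) → Fin n → Fin n → ℝ} (j : Fin n)
    (hN : 0 < N) (hn : 2 ≤ n) (hB : Real.log n / N ≤ B)
    (hs₁ : 0 < s₁) (hβ : βs ∈ paramSpace G k s₁ s₂) (hν : 0 ≤ ν) (hνs : ν ≤ (s₂ : ℝ) / s₁)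
    (hX : IsRowwiseSubGaussian σ S X P) (hS : spectrum ℝ S ⊆ Set.Icc c c')
    (hε : IsGaussianNoise τ ε P) (hXε : IndepFun X ε P)
    (hlam : lam ∈ Set.Icc (A * (σ ^ 2 / c + 2 * σ) * (τ * √(Real.log n / N)))
      (C₁ * (τ * √(Real.log n / N))))
    (hlamg : lamg = lam * √(ν / (2 * (graphMaxDegree G : ℝ)) ^ (k + 1)))
    (hmu : mu ∈ Set.Icc (A * (σ ^ 2 / c + 2 * σ) * √(Real.log n / N))
      (C₁ * √(Real.log n / N)))
    (hb : ∀ᵐ ω ∂P, IsGPPLasso G k lamg lam (X ω) (response (X ω) βs (ε ω)) (βhat ω))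
    (hΘm : Measurable Θhat)
    (hΘ : ∀ᵐ ω ∂P, (climeFeasible (sampleCov (X ω)) mu).Nonempty →
      IsCLIME (sampleCov (X ω)) mu (Matrix.of (Θhat (X ω))))
    (hρ₁ : 36 * s₂ * (σ * σ * A * √(Real.log n / N)) ≤ c / 2)
    (hρ₂ : C₁ * √(Real.log n / N) ≤ 1 / 2) (hρ₃ : σ * σ * A * √(Real.log n / N) ≤ 1) :
    ∃ W : Ω → ℝ, Measurable W ∧ P.map W = gaussianReal 0 1 ∧
      P.real {ω | ¬ (0 < oneStepVar (Matrix.of (Θhat (X ω))) (X ω) j ∧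
        |√(N : ℝ) * (oneStep (Matrix.of (Θhat (X ω))) (X ω) (response (X ω) βs (ε ω)) (βhat ω) j
            - βs j) / (τ * √(oneStepVar (Matrix.of (Θhat (X ω))) (X ω) j)) - W ω|
          ≤ 144 * C₁ ^ 2 * √(c' + 1) / c * (s₂ * Real.log n / √(N : ℝ)))} ≤ 6 / n := by
  have hN' : (0 : ℝ) < N := by exact_mod_cast hN
  have hlog : 0 < Real.log n := Real.log_pos (by exact_mod_cast (by omega : 1 < n))
  obtain ⟨u, hum, hu1, hu⟩ := exists_measurable_unit_weights hN hΘm j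
  refine ⟨fun ω => ∑ i, u (X ω) i / τ * ε ω i, ?_,
    map_random_sum_mul_eq_gaussianReal hτ hε hX.measurable hXε hum hu1, ?_⟩
  · refine Finset.measurable_sum _ fun i _ => ?_
    exact (((measurable_pi_apply i).comp (hum.comp hX.measurable)).div_const τ).mul
      ((measurable_pi_apply i).comp hε.measurable)
  refine le_trans (ENNReal.toReal_mono (measure_ne_top _ _) (measure_mono_ae ?_))
    (measureReal_compl_designEvent_le hAB hN hn hB hσ hτ hX hε hXε hc hS)
  filter_upwards [hb, hΘ] with ω hbω hΘω
  intro hbad hgood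
  refine hbad ?_
  clear hbad
  set ρ := √(Real.log n / N) with hρ
  have hρ0 : 0 < ρ := Real.sqrt_pos.2 (by positivity)
  obtain ⟨g1, g2, g3⟩ := hgood
  set x := X ω with hx
  have hherm := hX.isHermitian hN
  have hmu1 : σ * (1 / c) * σ * A * ρ ≤ mu := by
    refine le_trans ?_ hmu.1
    have : A * (σ ^ 2 / c + 2 * σ) * ρ = σ * (1 / c) * σ * A * ρ + 2 * A * σ * ρ := by ring
    rw [this]
    have : 0 ≤ 2 * A * σ * ρ := by positivity
    linarith
  have hlam1 : σ * τ * A * ρ ≤ lam / 2 := by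
    have : A * (σ ^ 2 / c + 2 * σ) * (τ * ρ) = A * (σ ^ 2 / c) * (τ * ρ) + 2 * (σ * τ * A * ρ) := by
      ring
    have h2 := hlam.1
    rw [this] at h2
    have : 0 ≤ A * (σ ^ 2 / c) * (τ * ρ) := by positivity
    linarith
  have hlam0 : 0 < lam := by
    have : 0 < σ * τ * A * ρ := by positivity
    linarith
  have hmu2 : mu ≤ 1 / 2 := hmu.2.trans hρ₂
  have hmu0 : 0 ≤ mu := le_trans (by positivity) hmu1
  -- The population precision matrix satisfies the constraint on this event, so the program is
  -- feasible and its solution obeys the constraint as well.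
  obtain ⟨hfeas, -⟩ := hΘω ⟨S⁻¹, fun a b => (g2 a b).trans hmu1⟩
  have hL1 : vecL1 (βhat ω - βs) ≤ 72 / c * s₂ * lam :=
    hbω.vecL1_sub_le hlam0 hc hs₁ hβ hν hνs hlamg (fun a => (g3 a).trans hlam1)
      (fun v => (dotProduct_mulVec_mem_Icc_of_spectrum_subset hherm hS v).1) (by positivity) g1 hρ₁
  set Θ := Matrix.of (Θhat x) with hΘdef
  set V := oneStepVar Θ x j with hV
  have hdiag : sampleCov x j j ≤ c' + 1 := by
    have h1 := (abs_le.1 ((g1 j j).trans hρ₃)).2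
    rw [Matrix.sub_apply] at h1
    linarith [diag_le_of_spectrum_subset hherm hS j]
  have hV0 : 0 ≤ V := by
    rw [hV, oneStepVar_eq]
    exact mul_nonneg (by positivity) (Finset.sum_nonneg fun _ _ => sq_nonneg _)
  have hVlow : 1 / 4 ≤ V * (c' + 1) := by
    have h1 := one_sub_sq_le_oneStepVar_mul hfeas (by linarith) j
    have h2 : V * sampleCov x j j ≤ V * (c' + 1) := mul_le_mul_of_nonneg_left hdiag hV0
    nlinarith
  have hVpos : 0 < V := pos_of_mul_pos_left (lt_of_lt_of_le (by norm_num) hVlow) (by positivity)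
  -- Since μ ≤ 1/2, V is at least 1/(4(c' + 1)); in this form the bound can multiply the bias and
  -- produce the denominator √V.
  have hsV : 1 ≤ 2 * √(c' + 1) * √V := by
    have h1 : √(1 / 4) ≤ √(V * (c' + 1)) := Real.sqrt_le_sqrt hVlow
    rw [Real.sqrt_mul hV0, show (1 / 4 : ℝ) = (1 / 2) ^ 2 by norm_num,
      Real.sqrt_sq (by norm_num)] at h1
    linarith
  have hsV0 : 0 < √V := Real.sqrt_pos.2 hVpos
  have hsN : 0 < √(N : ℝ) := Real.sqrt_pos.2 hN'
  have hsN2 : √(N : ℝ) ^ 2 = N := Real.sq_sqrt hN'.le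
  refine ⟨hVpos, ?_⟩
  set R := ∑ a, (Θ * sampleCov x - 1) j a * (βhat ω - βs) a with hR
  have hRle : |R| ≤ mu * (72 / c * s₂ * lam) :=
    (abs_sum_mul_le_mul_vecL1 fun a => hfeas j a).trans (mul_le_mul_of_nonneg_left hL1 hmu0)
  -- As V > 0, the weights are (XΘ_j)_i/(√N√V), so W cancels the noise term exactly and the bias is
  -- all that is left.
  have hdecomp : √(N : ℝ) * (oneStep Θ x (response x βs (ε ω)) (βhat ω) j - βs j) / (τ * √V)
      - ∑ i, u x i / τ * ε ω i = -(√(N : ℝ) * R / (τ * √V)) := by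
    rw [oneStep_response_sub]
    have h1 : ∑ i, u x i / τ * ε ω i
        = (∑ i, (Matrix.of x *ᵥ Θ j) i * ε ω i) / (√(N : ℝ) * √V * τ) := by
      rw [Finset.sum_div]
      refine Finset.sum_congr rfl fun i _ => ?_
      rw [hu x hVpos i]
      change (Matrix.of x *ᵥ Θ j) i / (√(N : ℝ) * √V) / τ * ε ω i = _
      field_simp
    rw [h1, ← hR]
    have h2 : 1 / (N : ℝ) = 1 / √(N : ℝ) ^ 2 := by rw [hsN2]
    rw [h2]
    field_simp
    ring
  rw [hdecomp, abs_neg, abs_div, abs_mul, abs_of_pos hsN, abs_of_pos (by positivity : 0 < τ * √V),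
    div_le_iff₀ (by positivity)]
  have hρ2 : √(N : ℝ) * ρ ^ 2 = Real.log n / √(N : ℝ) := by
    rw [hρ, Real.sq_sqrt (by positivity)]
    nth_rewrite 2 [← hsN2]
    field_simp
  have hC₁ρ : 0 ≤ C₁ * ρ := hmu0.trans hmu.2
  calc √(N : ℝ) * |R| ≤ √(N : ℝ) * (mu * (72 / c * s₂ * lam)) :=
        mul_le_mul_of_nonneg_left hRle hsN.le
    _ ≤ √(N : ℝ) * (C₁ * ρ * (72 / c * s₂ * (C₁ * (τ * ρ)))) := by
        refine mul_le_mul_of_nonneg_left ?_ hsN.le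
        refine mul_le_mul hmu.2 ?_ (by positivity) hC₁ρ
        exact mul_le_mul_of_nonneg_left hlam.2 (by positivity)
    _ = 72 * C₁ ^ 2 / c * s₂ * τ * (√(N : ℝ) * ρ ^ 2) := by ring
    _ = 72 * C₁ ^ 2 / c * (s₂ * Real.log n / √(N : ℝ)) * τ * 1 := by rw [hρ2]; ring
    _ ≤ 72 * C₁ ^ 2 / c * (s₂ * Real.log n / √(N : ℝ)) * τ * (2 * √(c' + 1) * √V) :=
        mul_le_mul_of_nonneg_left hsV (by positivity)
    _ = 144 * C₁ ^ 2 * √(c' + 1) / c * (s₂ * Real.log n / √(N : ℝ)) * (τ * √V) := by ring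

/-! ### Measurability of the statistic and tools for the limit -/

theorem measurable_oneStep_apply {Ω : Type*} [MeasurableSpace Ω] {N n : ℕ}
    {X : Ω → Fin N → Fin n → ℝ} {ε : Ω → Fin N → ℝ} {βhat : Ω → Fin n → ℝ}
    {Θhat : (Fin N → Fin n → ℝ) → Fin n → Fin n → ℝ} (hX : Measurable X) (hε : Measurable ε)
    (hb : Measurable βhat) (hΘ : Measurable Θhat) (βs : Fin n → ℝ) (j : Fin n) :
    Measurable fun ω => oneStep (Matrix.of (Θhat (X ω))) (X ω) (response (X ω) βs (ε ω))
      (βhat ω) j := by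
  have hXa : ∀ i a, Measurable fun ω => X ω i a := fun i a =>
    (measurable_pi_apply a).comp ((measurable_pi_apply i).comp hX)
  have hεa : ∀ i, Measurable fun ω => ε ω i := fun i => (measurable_pi_apply i).comp hε
  have hba : ∀ a, Measurable fun ω => βhat ω a := fun a => (measurable_pi_apply a).comp hb
  have hΘa : ∀ a, Measurable fun ω => Θhat (X ω) j a := fun a =>
    (measurable_pi_apply a).comp ((measurable_pi_apply j).comp (hΘ.comp hX))
  have hfit : ∀ i, Measurable fun ω => ∑ c, X ω i c * βhat ω c := fun i =>
    Finset.measurable_sum _ fun c _ => (hXa i c).mul (hba c)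
  have hmean : ∀ i, Measurable fun ω => ∑ c, X ω i c * βs c := fun i =>
    Finset.measurable_sum _ fun c _ => (hXa i c).mul_const _
  have hscore : ∀ a, Measurable fun ω => ∑ i, X ω i a *
      (∑ c, X ω i c * βs c + ε ω i - ∑ c, X ω i c * βhat ω c) := fun a =>
    Finset.measurable_sum _ fun i _ => (hXa i a).mul (((hmean i).add (hεa i)).sub (hfit i))
  have hsum : Measurable fun ω => ∑ a, Θhat (X ω) j a * ∑ i, X ω i a *
      (∑ c, X ω i c * βs c + ε ω i - ∑ c, X ω i c * βhat ω c) :=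
    Finset.measurable_sum _ fun a _ => (hΘa a).mul (hscore a)
  exact (hba j).add (hsum.const_mul (1 / (N : ℝ)))

theorem measurable_oneStepVar {Ω : Type*} [MeasurableSpace Ω] {N n : ℕ}
    {X : Ω → Fin N → Fin n → ℝ} {Θhat : (Fin N → Fin n → ℝ) → Fin n → Fin n → ℝ}
    (hX : Measurable X) (hΘ : Measurable Θhat) (j : Fin n) :
    Measurable fun ω => oneStepVar (Matrix.of (Θhat (X ω))) (X ω) j := by
  simp only [oneStepVar_eq]
  exact (Finset.measurable_sum _ fun i _ =>
    ((measurable_mulVec_row hΘ j i).comp hX).pow_const 2).const_mul _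

theorem mem_Icc_iff_abs_div_le {N σ V z b β : ℝ} (hN : 0 < N) (hσ : 0 < σ) (hV : 0 < V) :
    β ∈ Set.Icc (b - z * σ * √(V / N)) (b + z * σ * √(V / N))
      ↔ |√N * (b - β) / (σ * √V)| ≤ z := by
  have h1 : 0 < √N := Real.sqrt_pos.2 hN
  have h2 : 0 < √V := Real.sqrt_pos.2 hV
  have h3 : z * σ * √(V / N) = z * (σ * √V) / √N := by rw [Real.sqrt_div hV.le]; ring
  rw [abs_div, abs_mul, abs_of_pos h1, abs_of_pos (mul_pos hσ h2), div_le_iff₀ (mul_pos hσ h2),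
    mul_comm (√N), ← le_div_iff₀ h1, ← h3, abs_sub_comm, abs_sub_le_iff, Set.mem_Icc]
  constructor <;> rintro ⟨h4, h5⟩ <;> constructor <;> linarith

/-- Each of E and E' lies in the union of the other with D, so their probabilities differ by at most
p; monotonicity and subadditivity require no measurability. -/
theorem tendsto_measureReal_of_eventually_close {Ω : ℕ → Type*} [∀ l, MeasurableSpace (Ω l)]
    {P : (l : ℕ) → Measure (Ω l)} [∀ l, IsProbabilityMeasure (P l)] {E E' D : (l : ℕ) → Set (Ω l)}
    {p : ℕ → ℝ} {x : ℝ} (hE : Tendsto (fun l => (P l).real (E l)) atTop (𝓝 x))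
    (hp : Tendsto p atTop (𝓝 0)) (hD : ∀ᶠ l in atTop, (P l).real (D l) ≤ p l)
    (hEE : ∀ᶠ l in atTop, ∀ ω ∉ D l, ω ∈ E l ↔ ω ∈ E' l) :
    Tendsto (fun l => (P l).real (E' l)) atTop (𝓝 x) := by
  have h1 : Tendsto (fun l => (P l).real (E l) - p l) atTop (𝓝 x) := by simpa using hE.sub hp
  have h2 : Tendsto (fun l => (P l).real (E l) + p l) atTop (𝓝 x) := by simpa using hE.add hp
  refine tendsto_of_tendsto_of_tendsto_of_le_of_le' h1 h2 ?_ ?_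
  · filter_upwards [hD, hEE] with l hl hE
    have : (P l).real (E l) ≤ (P l).real (E' l ∪ D l) := measureReal_mono fun ω hω => by
      by_cases h : ω ∈ D l
      · exact Or.inr h
      · exact Or.inl ((hE ω h).1 hω)
    linarith [measureReal_union_le (μ := P l) (E' l) (D l)]
  · filter_upwards [hD, hEE] with l hl hE
    have : (P l).real (E' l) ≤ (P l).real (E l ∪ D l) := measureReal_mono fun ω hω => by
      by_cases h : ω ∈ D l
      · exact Or.inr h
      · exact Or.inl ((hE ω h).2 hω)
    linarith [measureReal_union_le (μ := P l) (E l) (D l)]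

/-- For n ≥ 3 one has log n ≥ 1, so √(log n) ≤ log n. The restricted eigenvalue bound needs this
weaker rate. -/
theorem tendsto_mul_sqrt_log_div {N n s : ℕ → ℕ} (hn : Tendsto n atTop atTop)
    (h : Tendsto (fun l => (s l : ℝ) * Real.log (n l) / √(N l : ℝ)) atTop (𝓝 0)) :
    Tendsto (fun l => (s l : ℝ) * √(Real.log (n l) / N l)) atTop (𝓝 0) := by
  refine squeeze_zero' (Eventually.of_forall fun l => by positivity) ?_ h
  filter_upwards [hn.eventually_ge_atTop 3] with l hl
  have h1 : 1 ≤ Real.log (n l) := by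
    rw [Real.le_log_iff_exp_le (by positivity)]
    have : (3 : ℝ) ≤ n l := by exact_mod_cast hl
    linarith [Real.exp_one_lt_d9]
  rw [Real.sqrt_div (by linarith), mul_div_assoc]
  have h2 : √(Real.log (n l)) ≤ Real.log (n l) := by
    rw [Real.sqrt_le_left (by linarith)]
    nlinarith
  gcongr

/-! ### Asymptotic normality, coverage and size -/

theorem corollary2 (cmin cmax σx : ℝ) (hcmin : 0 < cmin) (hcmax : 0 < cmax) (hσx : 0 < σx) :
    -- the constants implied in the lower bounds for the tuning parameters
    ∃ C₀ : ℝ, 0 < C₀ ∧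
    ∀ (C₁ : ℝ) (k : ℕ) (ν : ℝ), 0 ≤ ν → ν < 1 →
    ∀ (N n s₁ s₂ : ℕ → ℕ) (σε M lam lamg mu : ℕ → ℝ)
      (G : (l : ℕ) → SimpleGraph (Fin (n l)))
      (βstar : (l : ℕ) → Fin (n l) → ℝ)
      (S : (l : ℕ) → Matrix (Fin (n l)) (Fin (n l)) ℝ)
      (Ω : ℕ → Type*) [∀ l, MeasurableSpace (Ω l)]
      (P : (l : ℕ) → Measure (Ω l)) [∀ l, IsProbabilityMeasure (P l)]
      (X : (l : ℕ) → Ω l → Fin (N l) → Fin (n l) → ℝ)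
      (ε : (l : ℕ) → Ω l → Fin (N l) → ℝ)
      (βhat : (l : ℕ) → Ω l → Fin (n l) → ℝ)
      (Θhat : (l : ℕ) → (Fin (N l) → Fin (n l) → ℝ) → Fin (n l) → Fin (n l) → ℝ)
      (j : (l : ℕ) → Fin (n l)),
    -- the asymptotic regime
    Tendsto N atTop atTop → Tendsto n atTop atTop →
    -- the linear model with a sub-Gaussian random design and an independent Gaussian noise
    (∀ l, 0 < s₁ l ∧ 0 < s₂ l ∧ βstar l ∈ paramSpace (G l) k (s₁ l) (s₂ l)) →
    (∀ l, ν ≤ (s₂ l : ℝ) / (s₁ l : ℝ)) →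
    (∀ l, IsRowwiseSubGaussian σx (S l) (X l) (P l)) →
    (∀ l, spectrum ℝ (S l) ⊆ Set.Icc cmin cmax) →
    (∀ l a, ∑ b, |(S l)⁻¹ a b| ≤ M l) →
    (∀ l, 0 < σε l ∧ IsGaussianNoise (σε l) (ε l) (P l)) →
    (∀ l, IndepFun (X l) (ε l) (P l)) →
    -- the tuning parameters
    (∀ l, lam l ∈ Set.Icc (C₀ * (σε l * √(Real.log (n l) / N l)))
      (C₁ * (σε l * √(Real.log (n l) / N l)))) →
    (∀ l, lamg l = lam l * √(ν / (2 * (graphMaxDegree (G l) : ℝ)) ^ (k + 1))) →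
    (∀ l, mu l ∈ Set.Icc (C₀ * √(Real.log (n l) / N l)) (C₁ * √(Real.log (n l) / N l))) →
    -- the Graph-Piecewise-Polynomial-Lasso and the CLIME estimator
    (∀ l, Measurable (βhat l)) →
    (∀ l, ∀ᵐ ω ∂(P l), IsGPPLasso (G l) k (lamg l) (lam l) (X l ω)
      (response (X l ω) (βstar l) (ε l ω)) (βhat l ω)) →
    (∀ l, Measurable (Θhat l)) →
    (∀ l, ∀ᵐ ω ∂(P l), (climeFeasible (sampleCov (X l ω)) (mu l)).Nonempty →
      IsCLIME (sampleCov (X l ω)) (mu l) (Matrix.of (Θhat l (X l ω)))) →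
    -- the rate conditions
    Tendsto (fun l => (s₂ l : ℝ) * Real.log (n l) / √(N l : ℝ)) atTop (𝓝 0) →
    Tendsto (fun l => M l * √(Real.log (n l) / N l)) atTop (𝓝 0) →
    -- the one-step estimator of the `j`-th coefficient and its variance factor
    let βtilde : (l : ℕ) → Ω l → ℝ := fun l ω =>
      oneStep (Matrix.of (Θhat l (X l ω))) (X l ω)
        (response (X l ω) (βstar l) (ε l ω)) (βhat l ω) (j l)
    let V : (l : ℕ) → Ω l → ℝ := fun l ω =>
      oneStepVar (Matrix.of (Θhat l (X l ω))) (X l ω) (j l)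
    -- asymptotic normality
    TendstoInDistribution
      (fun l ω => √(N l : ℝ) * (βtilde l ω - βstar l (j l)) / (σε l * √(V l ω)))
      atTop (id : ℝ → ℝ) P (gaussianReal 0 1) ∧
    ∀ α : ℝ, 0 < α → α < 1 →
      -- asymptotic coverage of the confidence interval
      Tendsto (fun l => (P l).real {ω | βstar l (j l) ∈ Set.Icc
          (βtilde l ω - stdNormalQuantile (1 - α / 2) * σε l * √(V l ω / N l))
          (βtilde l ω + stdNormalQuantile (1 - α / 2) * σε l * √(V l ω / N l))})
        atTop (𝓝 (1 - α)) ∧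
      -- asymptotic size of the two-sided test of `βstar l (j l) = 0`
      ((∀ l, βstar l (j l) = 0) →
        Tendsto (fun l => (P l).real {ω | stdNormalQuantile (1 - α / 2) <
            |√(N l : ℝ) * βtilde l ω / (σε l * √(V l ω))|})
          atTop (𝓝 α)) := by
  obtain ⟨A, B, hA, hB, hAB⟩ := exists_isProductBernsteinConst
  -- The summand σx²/cmin makes Σ_x⁻¹ feasible for CLIME at level μ; the summand 2σx makes λ at
  -- least twice the noise level of Xᵀε/N.
  refine ⟨A * (σx ^ 2 / cmin + 2 * σx), by positivity, ?_⟩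
  intro C₁ k ν hν _ N n s₁ s₂ σε M lam lamg mu G βstar S Ω _ P _ X ε βhat Θhat j hN hn hspace hratio
    hX hspec _ hε hXε hlam hlamg hmu hbm hb hΘm hΘ hrate _ βtilde V
  have hsρ := tendsto_mul_sqrt_log_div hn hrate
  have hρ : Tendsto (fun l => √(Real.log (n l) / N l)) atTop (𝓝 0) := by
    refine squeeze_zero (fun l => by positivity) (fun l => ?_) hsρ
    have h1 : (1 : ℝ) ≤ s₂ l := by exact_mod_cast (hspace l).2.1
    exact le_mul_of_one_le_left (by positivity) h1
  have hlogN : Tendsto (fun l => Real.log (n l) / N l) atTop (𝓝 0) := by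
    have h1 := hρ.mul hρ
    rw [mul_zero] at h1
    refine h1.congr fun l => Real.mul_self_sqrt ?_
    exact div_nonneg (Real.log_natCast_nonneg _) (Nat.cast_nonneg _)
  set T : (l : ℕ) → Ω l → ℝ := fun l ω =>
    √(N l : ℝ) * (βtilde l ω - βstar l (j l)) / (σε l * √(V l ω)) with hT
  set r : ℕ → ℝ := fun l =>
    144 * C₁ ^ 2 * √(cmax + 1) / cmin * (s₂ l * Real.log (n l) / √(N l : ℝ)) with hr
  have hr0 : Tendsto r atTop (𝓝 0) := by simpa using hrate.const_mul _
  have hp : Tendsto (fun l => (6 : ℝ) / n l) atTop (𝓝 0) :=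
    tendsto_const_nhds.div_atTop (tendsto_natCast_atTop_atTop.comp hn)
  have hTm : ∀ l, Measurable (T l) := fun l =>
    (((measurable_oneStep_apply (hX l).measurable (hε l).2.measurable (hbm l) (hΘm l) (βstar l)
      (j l)).sub_const _).const_mul _).div
        ((measurable_oneStepVar (hX l).measurable (hΘm l) (j l)).sqrt.const_mul _)
  have hclose : ∀ᶠ l in atTop, ∃ W : Ω l → ℝ, Measurable W ∧ (P l).map W = gaussianReal 0 1 ∧
      (P l).real {ω | ¬ (0 < V l ω ∧ |T l ω - W ω| ≤ r l)} ≤ 6 / n l := by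
    have e1 : ∀ᶠ l in atTop, 36 * σx * σx * A * (s₂ l * √(Real.log (n l) / N l)) ≤ cmin / 2 :=
      Tendsto.eventually_le_const (by positivity) (by simpa using hsρ.const_mul _)
    have e2 : ∀ᶠ l in atTop, C₁ * √(Real.log (n l) / N l) ≤ 1 / 2 :=
      Tendsto.eventually_le_const (by positivity) (by simpa using hρ.const_mul _)
    have e3 : ∀ᶠ l in atTop, σx * σx * A * √(Real.log (n l) / N l) ≤ 1 :=
      Tendsto.eventually_le_const (by positivity) (by simpa using hρ.const_mul _)
    filter_upwards [e1, e2, e3, hlogN.eventually_le_const hB, hN.eventually_gt_atTop 0,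
      hn.eventually_ge_atTop 2] with l h1 h2 h3 h4 h5 h6
    exact exists_close_standard_normal hA hAB hcmin hcmax hσx (hε l).1 (j l) h5 h6 h4
      (hspace l).1 (hspace l).2.2 hν (hratio l) (hX l) (hspec l) (hε l).2 (hXε l) (hlam l)
      (hlamg l) (hmu l) (hb l) (hΘm l) (hΘ l) (le_trans (le_of_eq (by ring)) h1) h2 h3
  have hdist : TendstoInDistribution T atTop (id : ℝ → ℝ) P (gaussianReal 0 1) := by
    refine tendstoInDistribution_of_eventually_close hTm hr0 hp ?_
    filter_upwards [hclose] with l ⟨W, hW, hWl, hbad⟩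
    have hlog : 0 ≤ Real.log (n l) := Real.log_natCast_nonneg _
    refine ⟨by positivity, W, hW, hWl, (measureReal_mono fun ω hω => ?_).trans hbad⟩
    exact fun h => absurd h.2 (not_le.2 hω)
  refine ⟨hdist, fun α hα0 hα1 => ⟨?_, fun hβ0 => ?_⟩⟩
  · have h1 := tendsto_real_stdNormalQuantile_lt_abs hTm hdist hα0 hα1
    have h2 : Tendsto (fun l => (P l).real {ω | |T l ω| ≤ stdNormalQuantile (1 - α / 2)}) atTop
        (𝓝 (1 - α)) := by
      refine (h1.const_sub 1).congr fun l => ?_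
      have hm : MeasurableSet {ω | stdNormalQuantile (1 - α / 2) < |T l ω|} :=
        measurableSet_lt measurable_const (hTm l).abs
      rw [← probReal_compl_eq_one_sub hm]
      congr 1
      ext ω
      simp
    -- Where V vanishes the interval is a single point while the quotient T is 0 by convention, so
    -- coverage and |T| ≤ z may disagree there; that event has probability at most 6/n.
    refine tendsto_measureReal_of_eventually_close (D := fun l => {ω | ¬ 0 < V l ω}) h2 hp ?_ ?_
    · filter_upwards [hclose] with l ⟨W, _, _, hbad⟩
      refine (measureReal_mono fun ω hω => ?_).trans hbad
      exact fun h => hω h.1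
    · filter_upwards [hN.eventually_gt_atTop 0] with l hl ω hω
      exact (mem_Icc_iff_abs_div_le (by exact_mod_cast hl) (hε l).1 (not_not.1 hω)).symm
  · have h1 := tendsto_real_stdNormalQuantile_lt_abs hTm hdist hα0 hα1
    simpa only [hT, hβ0, sub_zero] using h1
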